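/- Let $b,m\in\mathbb Z$. For an odd prime $p\nmid bm(b^2+4m^2)$ let $\left(\frac{\cdot}{p}\right)$ be the Legendre symbol, and let $\left(\frac{b+2mi}{p}\right)_4$ be the quartic Jacobi symbol, that is, the product of $\left(\frac{b+2mi}{\pi}\right)_4$ over the prime factors $\pi$ of $p$ in $\mathbb Z[i]$ (with multiplicity), where $\left(\frac{\alpha}{\pi}\right)_4\in\{1,i,-1,-i\}$ is determined, for $\pi\nmid\alpha$, by $\left(\frac{\alpha}{\pi}\right)_4\equiv\alpha^{(N\pi-1)/4}\pmod\pi$, with $N\pi$ the norm of $\pi$. Congruences modulo $p$ between rational numbers with denominators prime to $p$ are understood in the ring of such rationals. For every such $p$ put $$\delta_p=\begin{cases}\left(\frac{b+2mi}{p}\right)_4&\text{if }\left(\frac{b^2+4m^2}{p}\right)=1,\\[2pt] \left(\frac{b+2mi}{p}\right)_4\, i&\text{if }\left(\frac{b^2+4m^2}{p}\right)=-1.\end{cases}$$ Then $\delta_p\in\{1,-1\}$, $$\left(\frac bp\right)\sum_{k=0}^{[p/4]}\binom{4k}{2k}\left(-\frac{m^2}{4b^2}\right)^k\equiv\begin{cases}\delta_p(b^2+4m^2)^{\frac{p-1}4}\pmod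 p&\text{if }4\mid p-1,\ \left(\frac{b^2+4m^2}{p}\right)=1,\\ b\,\delta_p(b^2+4m^2)^{\frac{p-3}4}\pmod p&\text{if }4\mid p-3,\ \left(\frac{b^2+4m^2}{p}\right)=1,\\ 0\pmod p&\text{if }4\mid p-1,\ \left(\frac{b^2+4m^2}{p}\right)=-1,\\ 2m\,\delta_p(b^2+4m^2)^{\frac{p-3}4}\pmod p&\text{if }4\mid p-3,\ \left(\frac{b^2+4m^2}{p}\right)=-1,\end{cases}$$ and $$\left(\frac mp\right)\sum_{k=0}^{[p/4]}\binom{4k}{2k}\left(-\frac{b^2}{64m^2}\right)^k\equiv\begin{cases}\delta_p(b^2+4m^2)^{\frac{p-1}4}\pmod p&\text{if }4\mid p-1,\ \left(\frac{b^2+4m^2}{p}\right)=1,\\ 2m\,\delta_p(b^2+4m^2)^{\frac{p-3}4}\pmod p&\text{if }4\mid p-3,\ \left(\frac{b^2+4m^2}{p}\right)=1,\\ 0\pmod p&\text{if }4\mid p-1,\ \left(\frac{b^2+4m^2}{p}\right)=-1,\\ -b\,\delta_p(b^2+4m^2)^{\frac{p-3}4}\pmod p&\text{if }4\mid p-3,\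 \left(\frac{b^2+4m^2}{p}\right)=-1.\end{cases}$$ Unless $4\mid p-1$ and $\left(\frac{b^2+4m^2}{p}\right)=-1$ (when both sums are $\equiv 0$ and $\delta_p$ does not occur), $\delta_p$ is the unique element of $\{1,-1\}$ satisfying these congruences. Moreover, if $p'$ is also an odd prime with $p'\nmid bm(b^2+4m^2)$ and $p'\equiv\pm p\pmod{(3-(-1)^b)(b^2+4m^2)}$, then $\delta_p=\delta_{p'}$. -/

import Mathlib

namespace QuarticSums

/-- The imaginary unit of `ℤ[i]`. -/
def gI : GaussianInt := ⟨0, 1⟩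

open Classical in
/-- The quartic residue symbol `(α/π)₄` for a Gaussian prime `π` not associated to `1 + i`:
the element of `{1, i, -1, -i}` congruent to `α ^ ((N π - 1) / 4)` modulo `π`, and `0` if `π ∣ α`
(in that case none of the four congruences below holds). -/
noncomputable def quarticResidueSymbol (α π : GaussianInt) : GaussianInt :=
  if π ∣ α ^ ((π.norm.natAbs - 1) / 4) - 1 then 1
  else if π ∣ α ^ ((π.norm.natAbs - 1) / 4) - gI then gI
  else if π ∣ α ^ ((π.norm.natAbs - 1) / 4) - (-1) then -1
  else if π ∣ α ^ ((π.norm.natAbs - 1) / 4) - (-gI) then -gI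
  else 0

/-- The quartic Jacobi symbol `(α/β)₄` for `β` prime to `1 + i`: the product of the quartic residue
symbols `(α/π)₄` over the Gaussian prime factors `π` of `β`, with multiplicity. (Each factor is
unique up to a unit, and the residue symbol does not change when `π` is multiplied by a unit.) -/
noncomputable def quarticJacobiSymbol (α β : GaussianInt) : GaussianInt :=
  ((UniqueFactorizationMonoid.factors β).map (quarticResidueSymbol α)).prod

/-- `∑_{k=0}^{[p/4]} C(4k, 2k) x^k` in the field of residues modulo `p`. -/
def binomSum (p : ℕ) (x : ZMod p) : ZMod p :=
  ∑ k ∈ Finset.range (p / 4 + 1), ((4 * k).choose (2 * k) : ZMod p) * x ^ k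

/-- The two systems of congruences modulo `p`, for a given sign `δ`. -/
def SumCongruences (b m : ℤ) (p : ℕ) [Fact p.Prime] (δ : ℤ) : Prop :=
  let S₁ : ZMod p := (legendreSym p b : ZMod p) *
    binomSum p (-((m : ZMod p) ^ 2 / (4 * (b : ZMod p) ^ 2)))
  let S₂ : ZMod p := (legendreSym p m : ZMod p) *
    binomSum p (-((b : ZMod p) ^ 2 / (64 * (m : ZMod p) ^ 2)))
  let D : ℤ := b ^ 2 + 4 * m ^ 2
  (p % 4 = 1 → legendreSym p D = 1 →
      S₁ = ((δ * D ^ ((p - 1) / 4) : ℤ) : ZMod p) ∧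
      S₂ = ((δ * D ^ ((p - 1) / 4) : ℤ) : ZMod p)) ∧
  (p % 4 = 3 → legendreSym p D = 1 →
      S₁ = ((b * δ * D ^ ((p - 3) / 4) : ℤ) : ZMod p) ∧
      S₂ = ((2 * m * δ * D ^ ((p - 3) / 4) : ℤ) : ZMod p)) ∧
  (p % 4 = 1 → legendreSym p D = -1 → S₁ = 0 ∧ S₂ = 0) ∧
  (p % 4 = 3 → legendreSym p D = -1 →
      S₁ = ((2 * m * δ * D ^ ((p - 3) / 4) : ℤ) : ZMod p) ∧
      S₂ = ((-b * δ * D ^ ((p - 3) / 4) : ℤ) : ZMod p))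

end QuarticSums

/-!
Let `p` be an odd prime, `p* = ± p ≡ 1 (mod 4)`, and let `φ : ℤ[i] → K` be a ring homomorphism to
a field of characteristic `p`. Since `x ↦ x ^ p` acts on the image of `φ` as the identity or as
complex conjugation, according to `p` modulo `4`,
`φ((α/p)₄) = (φ(α) / φ(ᾱ)) ^ ((p* - 1) / 4)` whenever `p ∤ N α`.

Modulo `p` we have `C(2j, j) ≡ C((p - 1) / 2, j) (-4) ^ j`, so for `α = u + vi` twice the sum with
argument `-(v / 4u) ^ 2` is `(u/p) (φ(α) ^ ((p - 1) / 2) + φ(ᾱ) ^ ((p - 1) / 2))`, and these powers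
are expressed by `(α/p)₄`, `N α` and, if `p ≡ 3 (mod 4)`, one further factor `α` or `ᾱ`.
With `α = b + 2mi` this gives the first system of congruences, and the second one follows by
replacing `α` by `iᾱ = 2m + bi`.

That `δ_p` depends only on `± p` modulo `(3 - (-1) ^ b)(b ^ 2 + 4m ^ 2)` is quartic reciprocity:
`(γ/p)₄ = (p*/γ)₄` for primary `γ`. For a primary prime `π` of prime norm `q`, with quartic residue
character `χ`, the Jacobi sum `J(χ, χ²)` equals `-π`, so a Gauss sum of `χ` over `K` has fourth
power `φ(π) ^ 3 φ(π̄)`; comparing this with the action of `x ↦ x ^ p` on the Gauss sum gives the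
law. The factors `η` of `b + 2mi` that are not primary, units and powers of `1 + i`, satisfy
`η = w η̄` with `w` a unit, so that `(η/p)₄ = w ^ ((p* - 1) / 4)`.
-/

namespace QuarticSums

theorem gI_mul_gI : gI * gI = -1 := by decide

theorem norm_eq (z : GaussianInt) : z.norm = z.re ^ 2 + z.im ^ 2 := by
  rw [Zsqrtd.norm_def]; ring

theorem isUnit_iff {z : GaussianInt} : IsUnit z ↔ z = 1 ∨ z = gI ∨ z = -1 ∨ z = -gI := by
  constructor
  · intro h
    have hz : z.re ^ 2 + z.im ^ 2 = 1 :=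
      norm_eq z ▸ (Zsqrtd.norm_eq_one_iff' (by norm_num) z).2 h
    obtain ⟨x, y⟩ := z
    dsimp only at hz
    have hx : x ≤ 1 := by nlinarith
    have hx' : -1 ≤ x := by nlinarith
    have hy : y ≤ 1 := by nlinarith
    have hy' : -1 ≤ y := by nlinarith
    interval_cases x <;> interval_cases y <;> first | omega | decide
  · have hI : IsUnit gI := IsUnit.of_mul_eq_one (-gI) (by rw [mul_neg, gI_mul_gI, neg_neg])
    rintro (rfl | rfl | rfl | rfl)
    exacts [isUnit_one, hI, isUnit_one.neg, hI.neg]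

theorem isUnit_gI : IsUnit gI := isUnit_iff.2 (by simp)

theorem mul_star_eq_one {u : GaussianInt} (hu : IsUnit u) : u * star u = 1 := by
  rw [← Zsqrtd.norm_eq_mul_conj, (Zsqrtd.norm_eq_one_iff' (by norm_num) u).2 hu, Int.cast_one]

theorem pow_four_eq_one {u : GaussianInt} (hu : IsUnit u) : u ^ 4 = 1 := by
  rcases isUnit_iff.1 hu with rfl | rfl | rfl | rfl <;> decide

theorem norm_sub_dvd_four {u v : GaussianInt} (hu : IsUnit u) (hv : IsUnit v) (h : u ≠ v) :
    (u - v).norm ∣ 4 := by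
  rcases isUnit_iff.1 hu with rfl | rfl | rfl | rfl <;>
    rcases isUnit_iff.1 hv with rfl | rfl | rfl | rfl <;> first | contradiction | decide

theorem norm_dvd_norm {x y : GaussianInt} (h : x ∣ y) : x.norm ∣ y.norm :=
  map_dvd Zsqrtd.normMonoidHom h

theorem isUnit_of_norm_dvd_four {z : GaussianInt} (hz : Odd z.norm) (h : z.norm ∣ 4) :
    IsUnit z := by
  have hco : IsCoprime z.norm (2 ^ 2) := (Int.isCoprime_two_right.2 hz).pow_right
  exact Zsqrtd.norm_eq_one_iff.1 (Int.isUnit_iff_natAbs_eq.1 (hco.isUnit_of_dvd' dvd_rfl h))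

theorem eq_of_isUnit_of_dvd_sub {π u v : GaussianInt} (hπ : ¬ IsUnit π) (hodd : Odd π.norm)
    (hu : IsUnit u) (hv : IsUnit v) (h : π ∣ u - v) : u = v := by
  by_contra hne
  exact hπ (isUnit_of_norm_dvd_four hodd ((norm_dvd_norm h).trans (norm_sub_dvd_four hu hv hne)))

theorem mod_four_of_prime {p : ℕ} (hp : p.Prime) (h2 : p ≠ 2) : p % 4 = 1 ∨ p % 4 = 3 :=
  Nat.odd_mod_four_iff.1 (Nat.odd_iff.1 (hp.odd_of_ne_two h2))

section Frobenius

variable {p : ℕ} [hp : Fact p.Prime]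

theorem natCast_dvd_pow_sub (z : GaussianInt) :
    (p : GaussianInt) ∣ z ^ p - (z.re + gI ^ p * z.im) := by
  have hint (n : ℤ) : (p : GaussianInt) ∣ (n : GaussianInt) ^ p - n := by
    exact_mod_cast (Zsqrtd.intCast_dvd_intCast (d := -1) (p : ℤ) (n ^ p - n)).2
      (Int.modEq_iff_dvd.1 (Int.ModEq.pow_prime_eq_self hp.out n).symm)
  obtain ⟨r, hr⟩ := exists_add_pow_prime_eq hp.out (z.re : GaussianInt) (gI * z.im)
  have hz : z = z.re + gI * z.im := by ext <;> simp [gI]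
  have hpow : z ^ p - (z.re + gI ^ p * z.im) = (z.re ^ p - z.re : GaussianInt) +
      gI ^ p * (z.im ^ p - z.im) + p * (z.re * (gI * z.im) * r) := by
    nth_rw 1 [hz]
    rw [hr]
    ring
  rw [hpow]
  exact ((hint _).add ((hint _).mul_left _)).add (dvd_mul_right _ _)

theorem gI_pow_of_mod_four_eq_one {n : ℕ} (h1 : n % 4 = 1) : gI ^ n = gI := by
  rw [← Nat.div_add_mod n 4, h1, pow_succ, pow_mul, pow_four_eq_one isUnit_gI, one_pow, one_mul]

theorem gI_pow_of_mod_four_eq_three {n : ℕ} (h3 : n % 4 = 3) : gI ^ n = -gI := by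
  rw [← Nat.div_add_mod n 4, h3, pow_add, pow_mul, pow_four_eq_one isUnit_gI, one_pow, one_mul]
  decide

theorem natCast_dvd_pow_sub_self (h1 : p % 4 = 1) (z : GaussianInt) :
    (p : GaussianInt) ∣ z ^ p - z := by
  convert natCast_dvd_pow_sub (p := p) z using 2
  rw [gI_pow_of_mod_four_eq_one h1]
  ext <;> simp [gI]

theorem natCast_dvd_pow_sub_star (h3 : p % 4 = 3) (z : GaussianInt) :
    (p : GaussianInt) ∣ z ^ p - star z := by
  convert natCast_dvd_pow_sub (p := p) z using 2
  rw [gI_pow_of_mod_four_eq_three h3]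
  ext <;> simp [gI]

end Frobenius

section OddPrimes

theorem irreducible_of_norm_prime {z : GaussianInt} {q : ℕ} (hq : q.Prime) (hz : z.norm = q) :
    Irreducible z := by
  constructor
  · intro h
    have hone : z.norm = 1 := (Zsqrtd.norm_eq_one_iff' (by norm_num) z).2 h
    rw [hz] at hone
    exact hq.one_lt.ne' (by exact_mod_cast hone)
  · rintro x y rfl
    have hxy := congrArg Int.natAbs hz
    rw [Zsqrtd.norm_mul, Int.natAbs_mul, Int.natAbs_natCast] at hxy
    rcases Nat.prime_mul_iff.1 (hxy ▸ hq) with ⟨_, hy⟩ | ⟨_, hx⟩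
    · exact Or.inr (Zsqrtd.norm_eq_one_iff.1 hy)
    · exact Or.inl (Zsqrtd.norm_eq_one_iff.1 hx)

theorem exists_norm_eq_of_mod_four_eq_one {p : ℕ} [Fact p.Prime] (h1 : p % 4 = 1) :
    ∃ l : GaussianInt, l.norm = p := by
  obtain ⟨a, b, h⟩ := Nat.Prime.sq_add_sq (p := p) (by omega)
  exact ⟨⟨a, b⟩, by rw [norm_eq]; simpa using congrArg (Nat.cast (R := ℤ)) h⟩

theorem exists_prime_dvd_natCast {π : GaussianInt} (hπ : Prime π) :
    ∃ q : ℕ, q.Prime ∧ π ∣ (q : GaussianInt) := by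
  have hN : (π.norm.natAbs.primeFactorsList : Multiset ℕ).prod = π.norm.natAbs :=
    Nat.prod_primeFactorsList (Int.natAbs_ne_zero.2 (GaussianInt.norm_eq_zero.not.2 hπ.ne_zero))
  have hd : π ∣ ((π.norm.natAbs.primeFactorsList : Multiset ℕ).map Nat.cast).prod := by
    rw [← Nat.cast_multiset_prod, hN, GaussianInt.natCast_natAbs_norm, Zsqrtd.norm_eq_mul_conj]
    exact dvd_mul_right _ _
  obtain ⟨q, hq, hπq⟩ := hπ.exists_mem_multiset_map_dvd hd
  exact ⟨q, Nat.prime_of_mem_primeFactorsList hq, hπq⟩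

theorem norm_eq_or_associated_of_prime {π : GaussianInt} (hπ : Prime π) (hodd : Odd π.norm) :
    ∃ q : ℕ, q.Prime ∧
      (q % 4 = 1 ∧ π.norm = q ∨ q % 4 = 3 ∧ Associated (q : GaussianInt) π) := by
  obtain ⟨q, hq, hπq⟩ := exists_prime_dvd_natCast hπ
  have : Fact q.Prime := ⟨hq⟩
  have hq2 : q ≠ 2 := by
    rintro rfl
    exact hπ.not_isUnit (isUnit_of_norm_dvd_four hodd (norm_dvd_norm hπq))
  refine ⟨q, hq, (mod_four_of_prime hq hq2).imp (fun h1 => ⟨h1, ?_⟩) fun h3 => ⟨h3, ?_⟩⟩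
  · obtain ⟨l, hl⟩ := exists_norm_eq_of_mod_four_eq_one h1
    have hlπ : π ∣ l * star l := by
      rwa [← Zsqrtd.norm_eq_mul_conj, hl, Int.cast_natCast]
    rcases hπ.dvd_or_dvd hlπ with h | h
    · rw [← hl]
      exact Zsqrtd.norm_eq_of_associated (by norm_num)
        (hπ.irreducible.associated_of_dvd (irreducible_of_norm_prime hq hl) h)
    · rw [← hl, ← Zsqrtd.norm_conj l]
      exact Zsqrtd.norm_eq_of_associated (by norm_num) (hπ.irreducible.associated_of_dvd
        (irreducible_of_norm_prime hq (by rw [Zsqrtd.norm_conj, hl])) h)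
  · exact (hπ.irreducible.associated_of_dvd
      (GaussianInt.prime_of_nat_prime_of_mod_four_eq_three q h3).irreducible hπq).symm

theorem dvd_pow_norm_sub_one {π α : GaussianInt} (hπ : Prime π) (hodd : Odd π.norm)
    (hα : ¬ π ∣ α) : π ∣ α ^ (π.norm.natAbs - 1) - 1 := by
  suffices h : π ∣ α ^ π.norm.natAbs - α by
    have hN : π.norm.natAbs = π.norm.natAbs - 1 + 1 := by
      have := Int.natAbs_pos.2 (GaussianInt.norm_eq_zero.not.2 hπ.ne_zero)
      omega
    rw [hN, pow_succ, ← sub_one_mul] at h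
    exact (hπ.dvd_or_dvd h).resolve_right hα
  obtain ⟨q, hq, ⟨h1, hN⟩ | ⟨h3, hass⟩⟩ := norm_eq_or_associated_of_prime hπ hodd
  · have : Fact q.Prime := ⟨hq⟩
    have hπq : π ∣ (q : GaussianInt) := by
      rw [← Int.cast_natCast, ← hN, Zsqrtd.norm_eq_mul_conj]
      exact dvd_mul_right _ _
    rw [hN, Int.natAbs_natCast]
    exact hπq.trans (natCast_dvd_pow_sub_self h1 α)
  · have : Fact q.Prime := ⟨hq⟩
    rw [← Zsqrtd.norm_eq_of_associated (by norm_num) hass, Zsqrtd.norm_natCast, Int.natAbs_mul,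
      Int.natAbs_natCast, pow_mul]
    refine hass.symm.dvd.trans ?_
    have hstar := natCast_dvd_pow_sub_star h3 (star α)
    rw [star_star] at hstar
    convert ((natCast_dvd_pow_sub_star h3 α).trans (sub_dvd_pow_sub_pow _ _ q)).add hstar using 1
    ring

end OddPrimes

section ResidueSymbol

variable {α β π π' u : GaussianInt}

theorem norm_emod_four {z : GaussianInt} (hz : Odd z.norm) : z.norm % 4 = 1 := by
  rw [Int.odd_iff, norm_eq] at hz
  rw [norm_eq]
  rcases Int.even_or_odd' z.re with ⟨x, hx | hx⟩ <;>
    rcases Int.even_or_odd' z.im with ⟨y, hy | hy⟩ <;>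
    rw [hx, hy] at hz ⊢ <;> ring_nf at hz ⊢ <;> omega

theorem quarticResidueSymbol_spec_of_dvd (hu : IsUnit u)
    (h : π ∣ α ^ ((π.norm.natAbs - 1) / 4) - u) :
    IsUnit (quarticResidueSymbol α π) ∧
      π ∣ α ^ ((π.norm.natAbs - 1) / 4) - quarticResidueSymbol α π := by
  unfold quarticResidueSymbol
  split_ifs with h1 h2 h3 h4
  · exact ⟨isUnit_one, h1⟩
  · exact ⟨isUnit_gI, h2⟩
  · exact ⟨isUnit_one.neg, h3⟩
  · exact ⟨isUnit_gI.neg, h4⟩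
  · rcases isUnit_iff.1 hu with rfl | rfl | rfl | rfl <;> contradiction

theorem quarticResidueSymbol_eq_of_dvd (hπ : ¬ IsUnit π) (hodd : Odd π.norm) (hu : IsUnit u)
    (h : π ∣ α ^ ((π.norm.natAbs - 1) / 4) - u) : quarticResidueSymbol α π = u := by
  obtain ⟨hs, hd⟩ := quarticResidueSymbol_spec_of_dvd hu h
  exact eq_of_isUnit_of_dvd_sub hπ hodd hs hu (by simpa using h.sub hd)

theorem quarticResidueSymbol_spec (hπ : Prime π) (hodd : Odd π.norm) (hα : ¬ π ∣ α) :
    IsUnit (quarticResidueSymbol α π) ∧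
      π ∣ α ^ ((π.norm.natAbs - 1) / 4) - quarticResidueSymbol α π := by
  suffices h : ∃ u, IsUnit u ∧ π ∣ α ^ ((π.norm.natAbs - 1) / 4) - u from
    h.elim fun u hu => quarticResidueSymbol_spec_of_dvd hu.1 hu.2
  have hfermat := dvd_pow_norm_sub_one hπ hodd hα
  have hN : π.norm.natAbs - 1 = (π.norm.natAbs - 1) / 4 * 4 := by
    have := norm_emod_four hodd
    have := GaussianInt.norm_nonneg π
    omega
  rw [hN, pow_mul] at hfermat
  generalize α ^ ((π.norm.natAbs - 1) / 4) = x at hfermat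
  have hfactor : x ^ 4 - 1 = (x - 1) * (x - gI) * ((x - -1) * (x - -gI)) := by
    linear_combination (x ^ 2 - 1) * gI_mul_gI
  rw [hfactor] at hfermat
  rcases hπ.dvd_or_dvd hfermat with h | h <;> rcases hπ.dvd_or_dvd h with h | h
  exacts [⟨1, isUnit_one, h⟩, ⟨gI, isUnit_gI, h⟩, ⟨-1, isUnit_one.neg, h⟩, ⟨-gI, isUnit_gI.neg, h⟩]

theorem quarticResidueSymbol_of_dvd (hπ : ¬ IsUnit π) (hodd : Odd π.norm) (h : π ∣ α) :
    quarticResidueSymbol α π = 0 := by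
  have hexp : (π.norm.natAbs - 1) / 4 ≠ 0 := by
    have hne := mt Zsqrtd.norm_eq_one_iff.1 hπ
    have := norm_emod_four hodd
    have := GaussianInt.norm_nonneg π
    omega
  have hnd {u : GaussianInt} (hu : IsUnit u) : ¬ π ∣ α ^ ((π.norm.natAbs - 1) / 4) - u := fun hd =>
    hπ (isUnit_of_dvd_unit ((dvd_sub_right (dvd_pow h hexp)).1 hd) hu)
  rw [quarticResidueSymbol, if_neg (hnd isUnit_one), if_neg (hnd isUnit_gI),
    if_neg (hnd isUnit_one.neg), if_neg (hnd isUnit_gI.neg)]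

theorem quarticResidueSymbol_mul (hπ : Prime π) (hodd : Odd π.norm) (α β : GaussianInt) :
    quarticResidueSymbol (α * β) π = quarticResidueSymbol α π * quarticResidueSymbol β π := by
  have hzero {γ : GaussianInt} (h : π ∣ γ) := quarticResidueSymbol_of_dvd hπ.not_isUnit hodd h
  by_cases hα : π ∣ α
  · rw [hzero (hα.mul_right β), hzero hα, zero_mul]
  by_cases hβ : π ∣ β
  · rw [hzero (hβ.mul_left α), hzero hβ, mul_zero]
  obtain ⟨hu, hd⟩ := quarticResidueSymbol_spec hπ hodd hα
  obtain ⟨hu', hd'⟩ := quarticResidueSymbol_spec hπ hodd hβ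
  refine quarticResidueSymbol_eq_of_dvd hπ.not_isUnit hodd (hu.mul hu') ?_
  rw [mul_pow]
  exact dvd_mul_sub_mul hd hd'

theorem quarticResidueSymbol_star (hπ : Prime π) (hodd : Odd π.norm) (hα : ¬ π ∣ α) :
    quarticResidueSymbol (star α) (star π) = star (quarticResidueSymbol α π) := by
  obtain ⟨hu, hd⟩ := quarticResidueSymbol_spec hπ hodd hα
  refine quarticResidueSymbol_eq_of_dvd ?_ (by rwa [Zsqrtd.norm_conj]) hu.star ?_
  · exact fun h => hπ.not_isUnit (by simpa using h.star)
  · rw [Zsqrtd.norm_conj, ← star_pow, ← star_sub]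
    exact map_dvd (starRingEnd GaussianInt) hd

theorem quarticResidueSymbol_congr (h : π ∣ α - β) :
    quarticResidueSymbol α π = quarticResidueSymbol β π := by
  classical
  have hiff (u : GaussianInt) : π ∣ α ^ ((π.norm.natAbs - 1) / 4) - u ↔
      π ∣ β ^ ((π.norm.natAbs - 1) / 4) - u :=
    dvd_iff_dvd_of_dvd_sub (by simpa using h.trans (sub_dvd_pow_sub_pow α β _))
  unfold quarticResidueSymbol
  exact if_congr (hiff _) rfl <| if_congr (hiff _) rfl <| if_congr (hiff _) rfl <|
    if_congr (hiff _) rfl rfl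

theorem quarticResidueSymbol_of_associated (α : GaussianInt) (h : Associated π π') :
    quarticResidueSymbol α π = quarticResidueSymbol α π' := by
  classical
  have hd (z : GaussianInt) : π ∣ z ↔ π' ∣ z := h.dvd_iff_dvd_left
  unfold quarticResidueSymbol
  rw [Zsqrtd.norm_eq_of_associated (by norm_num) h]
  exact if_congr (hd _) rfl <| if_congr (hd _) rfl <| if_congr (hd _) rfl <| if_congr (hd _) rfl rfl

end ResidueSymbol

section JacobiSymbol

open UniqueFactorizationMonoid

variable {α α' β γ π : GaussianInt}

theorem odd_norm_of_dvd (h : π ∣ β) (hβ : Odd β.norm) : Odd π.norm := by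
  obtain ⟨c, rfl⟩ := h
  rw [Zsqrtd.norm_mul] at hβ
  exact (Int.odd_mul.1 hβ).1

theorem quarticJacobiSymbol_eq_prod (α : GaussianInt) {f : Multiset GaussianInt}
    (hf : ∀ x ∈ f, Irreducible x) (h : Associated f.prod β) :
    quarticJacobiSymbol α β = (f.map (quarticResidueSymbol α)).prod := by
  have hβ : β ≠ 0 :=
    h.ne_zero_iff.1 (Multiset.prod_ne_zero fun h0 => not_irreducible_zero (hf 0 h0))
  have hrel := factors_unique (fun x hx => irreducible_of_factor x hx) hf
    ((factors_prod hβ).trans h.symm)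
  unfold quarticJacobiSymbol
  congr 1
  rw [← Multiset.rel_eq, Multiset.rel_map]
  exact hrel.mono fun a _ b _ hab => quarticResidueSymbol_of_associated α hab

theorem quarticJacobiSymbol_of_irreducible (α : GaussianInt) (hπ : Irreducible π) :
    quarticJacobiSymbol α π = quarticResidueSymbol α π := by
  rw [quarticJacobiSymbol_eq_prod α (f := {π}) (by simpa using hπ) (by simp)]
  simp

theorem quarticJacobiSymbol_mul_right (α : GaussianInt) (hβ : β ≠ 0) (hγ : γ ≠ 0) :
    quarticJacobiSymbol α (β * γ) = quarticJacobiSymbol α β * quarticJacobiSymbol α γ := by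
  rw [quarticJacobiSymbol_eq_prod α (f := factors β + factors γ), Multiset.map_add,
    Multiset.prod_add, quarticJacobiSymbol, quarticJacobiSymbol]
  · exact fun x hx => (Multiset.mem_add.1 hx).elim (irreducible_of_factor x)
      (irreducible_of_factor x)
  · rw [Multiset.prod_add]
    exact (factors_prod hβ).mul_mul (factors_prod hγ)

theorem quarticJacobiSymbol_eq_zero (hπ : Prime π) (hodd : Odd β.norm) (hα : π ∣ α)
    (hβ : π ∣ β) : quarticJacobiSymbol α β = 0 := by
  have hπodd := odd_norm_of_dvd hβ hodd
  obtain ⟨γ, rfl⟩ := hβ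
  have hγ : γ ≠ 0 := by
    rintro rfl
    simp at hodd
  rw [quarticJacobiSymbol_mul_right α hπ.ne_zero hγ,
    quarticJacobiSymbol_of_irreducible α hπ.irreducible,
    quarticResidueSymbol_of_dvd hπ.not_isUnit hπodd hα, zero_mul]

theorem quarticJacobiSymbol_of_isUnit (α : GaussianInt) (hβ : IsUnit β) :
    quarticJacobiSymbol α β = 1 := by
  rw [quarticJacobiSymbol, factors_of_isUnit hβ, Multiset.map_zero, Multiset.prod_zero]

theorem quarticJacobiSymbol_congr (h : β ∣ α - α') :
    quarticJacobiSymbol α β = quarticJacobiSymbol α' β :=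
  congrArg Multiset.prod <| Multiset.map_congr rfl fun _ hπ =>
    quarticResidueSymbol_congr ((dvd_of_mem_factors hπ).trans h)

theorem not_dvd_of_mem_factors (h : IsCoprime α β) (hπ : π ∈ factors β) : ¬ π ∣ α := fun hd =>
  (prime_of_factor π hπ).not_isUnit (h.isUnit_of_dvd' hd (dvd_of_mem_factors hπ))

theorem isUnit_quarticJacobiSymbol (hβ : Odd β.norm) (h : IsCoprime α β) :
    IsUnit (quarticJacobiSymbol α β) := by
  refine Multiset.prod_induction IsUnit _ (fun _ _ => IsUnit.mul) isUnit_one fun s hs => ?_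
  obtain ⟨π, hπ, rfl⟩ := Multiset.mem_map.1 hs
  exact (quarticResidueSymbol_spec (prime_of_factor π hπ)
    (odd_norm_of_dvd (dvd_of_mem_factors hπ) hβ) (not_dvd_of_mem_factors h hπ)).1

theorem quarticJacobiSymbol_mul_left (hβ : Odd β.norm) (α α' : GaussianInt) :
    quarticJacobiSymbol (α * α') β = quarticJacobiSymbol α β * quarticJacobiSymbol α' β := by
  rw [quarticJacobiSymbol, quarticJacobiSymbol, quarticJacobiSymbol, ← Multiset.prod_map_mul]
  exact congrArg Multiset.prod <| Multiset.map_congr rfl fun π hπ =>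
    quarticResidueSymbol_mul (prime_of_factor π hπ)
      (odd_norm_of_dvd (dvd_of_mem_factors hπ) hβ) α α'

end JacobiSymbol

/-- The integer `p* = ± p` congruent to `1` modulo `4`, for odd `p`. -/
def pstar (p : ℕ) : ℤ := ZMod.χ₄ p * p

theorem pstar_of_one {p : ℕ} (h1 : p % 4 = 1) : pstar p = p := by
  rw [pstar, ZMod.χ₄_nat_one_mod_four h1, one_mul]

theorem pstar_of_three {p : ℕ} (h3 : p % 4 = 3) : pstar p = -p := by
  rw [pstar, ZMod.χ₄_nat_three_mod_four h3, neg_one_mul]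

theorem pstar_modEq_one {p : ℕ} (hp : p.Prime) (h2 : p ≠ 2) : pstar p ≡ 1 [ZMOD 4] := by
  rcases mod_four_of_prime hp h2 with h | h
  · rw [pstar_of_one h, Int.ModEq]
    omega
  · rw [pstar_of_three h, Int.ModEq]
    omega

theorem pstar_modEq {p p' : ℕ} {M : ℤ} (hM : 4 ∣ M)
    (h : (p' : ℤ) ≡ p [ZMOD M] ∨ (p' : ℤ) ≡ -p [ZMOD M]) : pstar p ≡ pstar p' [ZMOD M] := by
  have hcast {x y : ℤ} (hxy : x ≡ y [ZMOD M]) : (x : ZMod 4) = y :=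
    (ZMod.intCast_eq_intCast_iff x y 4).2 (hxy.of_dvd hM)
  have hneg : ∀ x : ZMod 4, ZMod.χ₄ (-x) = -ZMod.χ₄ x := by decide
  rcases h with h | h
  · have hp4 : (p' : ZMod 4) = p := by simpa using hcast h
    rw [pstar, pstar, hp4]
    exact (h.mul_left _).symm
  · have hp4 : (p' : ZMod 4) = -p := by simpa using hcast h
    rw [pstar, pstar, hp4, hneg, ← neg_mul_neg]
    simpa using (h.mul_left (-ZMod.χ₄ p)).symm

theorem not_natCast_dvd_two_pow {p : ℕ} (hp : p.Prime) (h2 : p ≠ 2) (k : ℕ) :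
    ¬ (p : ℤ) ∣ 2 ^ k := fun h =>
  h2 ((Nat.prime_dvd_prime_iff_eq hp Nat.prime_two).1 (hp.dvd_of_dvd_pow (by exact_mod_cast h)))

theorem not_natCast_dvd_pstar {p q : ℕ} (hp : p.Prime) (hq : q.Prime) (h2 : p ≠ 2) (hpq : p ≠ q) :
    ¬ (q : ℤ) ∣ pstar p := by
  have hqp : ¬ (q : ℤ) ∣ p := by
    rwa [Int.natCast_dvd_natCast, Nat.prime_dvd_prime_iff_eq hq hp, eq_comm]
  rcases mod_four_of_prime hp h2 with h | h
  · rwa [pstar_of_one h]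
  · rwa [pstar_of_three h, Int.dvd_neg]

theorem isCoprime_natCast {p : ℕ} [hp : Fact p.Prime] {α : GaussianInt}
    (hα : ¬ (p : ℤ) ∣ α.norm) : IsCoprime α (p : GaussianInt) := by
  have hco : IsCoprime α.norm (p : ℤ) :=
    ((Nat.prime_iff_prime_int.1 hp.out).coprime_iff_not_dvd.2 hα).symm
  have hcast : IsCoprime (α.norm : GaussianInt) (p : GaussianInt) := by
    simpa using hco.map (Int.castRingHom GaussianInt)
  exact hcast.of_isCoprime_of_dvd_left ⟨star α, Zsqrtd.norm_eq_mul_conj α⟩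

theorem odd_norm_natCast {p : ℕ} [hp : Fact p.Prime] (h2 : p ≠ 2) :
    Odd (p : GaussianInt).norm := by
  have hodd : Odd (p : ℤ) := (Int.odd_coe_nat p).2 (hp.out.odd_of_ne_two h2)
  rw [Zsqrtd.norm_natCast]
  exact hodd.mul hodd

theorem isUnit_quarticJacobiSymbol_natCast {p : ℕ} [Fact p.Prime] {α : GaussianInt}
    (h2 : p ≠ 2) (hα : ¬ (p : ℤ) ∣ α.norm) : IsUnit (quarticJacobiSymbol α p) :=
  isUnit_quarticJacobiSymbol (odd_norm_natCast h2) (isCoprime_natCast hα)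

section Hom

variable {R : Type*} [Field R] (φ : GaussianInt →+* R)

theorem hom_mul_star (z : GaussianInt) : φ z * φ (star z) = (z.norm : R) := by
  rw [← map_mul, ← Zsqrtd.norm_eq_mul_conj, map_intCast]

theorem hom_eq_of_dvd_sub {d x y : GaussianInt} (hd : φ d = 0) (h : d ∣ x - y) : φ x = φ y := by
  have hxy : φ d ∣ φ (x - y) := map_dvd φ h
  rwa [hd, zero_dvd_iff, map_sub, sub_eq_zero] at hxy

theorem hom_injOn_units (h2 : (2 : R) ≠ 0) {u v : GaussianInt} (hu : IsUnit u) (hv : IsUnit v)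
    (h : φ u = φ v) : u = v := by
  by_contra hne
  obtain ⟨c, hc⟩ := norm_sub_dvd_four hu hv hne
  have h4 : (4 : R) = 0 := by
    have hc' : (4 : R) = ((u - v).norm : R) * c := by exact_mod_cast congrArg (Int.cast (R := R)) hc
    rw [hc', ← hom_mul_star φ, map_sub, h, sub_self, zero_mul, zero_mul]
  exact mul_ne_zero h2 h2 (by linear_combination h4)

variable {p : ℕ} [CharP R p]

theorem hom_ne_zero {z : GaussianInt} (hz : ¬ (p : ℤ) ∣ z.norm) : φ z ≠ 0 := by
  intro h
  refine hz ((CharP.intCast_eq_zero_iff R p _).1 ?_)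
  rw [← hom_mul_star φ, h, zero_mul]

theorem hom_star_ne_zero {z : GaussianInt} (hz : ¬ (p : ℤ) ∣ z.norm) : φ (star z) ≠ 0 :=
  hom_ne_zero φ (p := p) (by rwa [Zsqrtd.norm_conj])

theorem hom_natCast_char : φ (p : GaussianInt) = 0 := by
  rw [map_natCast, CharP.cast_eq_zero]

variable [hp : Fact p.Prime] {α : GaussianInt}

theorem intCast_legendreSym (a : ℤ) : ((legendreSym p a : ℤ) : R) = (a : R) ^ (p / 2) := by
  simpa using congrArg (ZMod.castHom dvd_rfl R) (legendreSym.eq_pow p a)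

theorem hom_pow_char_of_one (h1 : p % 4 = 1) (z : GaussianInt) : φ z ^ p = φ z := by
  rw [← map_pow]
  exact hom_eq_of_dvd_sub φ (hom_natCast_char φ) (natCast_dvd_pow_sub_self h1 z)

theorem hom_pow_char_of_three (h3 : p % 4 = 3) (z : GaussianInt) : φ z ^ p = φ (star z) := by
  rw [← map_pow]
  exact hom_eq_of_dvd_sub φ (hom_natCast_char φ) (natCast_dvd_pow_sub_star h3 z)

theorem exists_norm_eq_and_hom_eq_zero (h1 : p % 4 = 1) :
    ∃ l : GaussianInt, l.norm = p ∧ φ l = 0 := by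
  obtain ⟨l, hl⟩ := exists_norm_eq_of_mod_four_eq_one h1
  have h0 := hom_mul_star φ l
  rw [hl, Int.cast_natCast, CharP.cast_eq_zero] at h0
  rcases mul_eq_zero.1 h0 with h | h
  · exact ⟨l, hl, h⟩
  · exact ⟨star l, by rw [Zsqrtd.norm_conj, hl], h⟩

theorem hom_quarticJacobiSymbol_of_one (h1 : p % 4 = 1) (hα : ¬ (p : ℤ) ∣ α.norm) :
    φ (quarticJacobiSymbol α p) = (φ α / φ (star α)) ^ ((p - 1) / 4) := by
  obtain ⟨l, hl, hφl⟩ := exists_norm_eq_and_hom_eq_zero φ h1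
  have hp2 : Odd (p : ℤ) := (Int.odd_coe_nat p).2 (Nat.odd_iff.2 (by omega))
  have hirr := irreducible_of_norm_prime hp.out hl
  have hirr' := irreducible_of_norm_prime (z := star l) hp.out (by rw [Zsqrtd.norm_conj, hl])
  have hsplit : (p : GaussianInt) = l * star l := by
    rw [← Zsqrtd.norm_eq_mul_conj, hl, Int.cast_natCast]
  have hnd {z : GaussianInt} (hz : ¬ (p : ℤ) ∣ z.norm) : ¬ l ∣ z := fun h =>
    hz (hl ▸ norm_dvd_norm h)
  have hα' : ¬ (p : ℤ) ∣ (star α).norm := by rwa [Zsqrtd.norm_conj]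
  have hres {z : GaussianInt} (hz : ¬ (p : ℤ) ∣ z.norm) :
      φ (quarticResidueSymbol z l) = φ z ^ ((p - 1) / 4) := by
    have hd := (quarticResidueSymbol_spec hirr.prime (hl ▸ hp2) (hnd hz)).2
    rw [hl, Int.natAbs_natCast] at hd
    rw [← hom_eq_of_dvd_sub φ hφl hd, map_pow]
  have hstar : φ (quarticResidueSymbol α (star l)) = (φ (star α) ^ ((p - 1) / 4))⁻¹ := by
    have hu := (quarticResidueSymbol_spec hirr.prime (hl ▸ hp2) (hnd hα')).1
    rw [← star_star α, quarticResidueSymbol_star hirr.prime (hl ▸ hp2) (hnd hα'), star_star,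
      ← hres hα']
    refine eq_inv_of_mul_eq_one_right ?_
    rw [← map_mul, mul_star_eq_one hu, map_one]
  rw [hsplit, quarticJacobiSymbol_mul_right α hirr.ne_zero hirr'.ne_zero,
    quarticJacobiSymbol_of_irreducible α hirr, quarticJacobiSymbol_of_irreducible α hirr', map_mul,
    hres hα, hstar, div_pow, div_eq_mul_inv]

theorem hom_quarticJacobiSymbol_of_three (h3 : p % 4 = 3) (hα : ¬ (p : ℤ) ∣ α.norm) :
    φ (quarticJacobiSymbol α p) = (φ (star α) / φ α) ^ ((p + 1) / 4) := by
  have hpr := GaussianInt.prime_of_nat_prime_of_mod_four_eq_three p h3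
  have hnd : ¬ (p : GaussianInt) ∣ α := fun h => by
    have := norm_dvd_norm h
    rw [Zsqrtd.norm_natCast] at this
    exact hα ((dvd_mul_right _ _).trans this)
  have hd := (quarticResidueSymbol_spec hpr (odd_norm_natCast (by omega)) hnd).2
  have hn : ((p : GaussianInt).norm.natAbs - 1) / 4 = (p - 1) * ((p + 1) / 4) := by
    have hsq : p * p = (p - 1) * ((p + 1) / 4) * 4 + 1 := by
      obtain ⟨k, rfl⟩ : ∃ k, p = 4 * k + 3 := ⟨p / 4, by omega⟩
      rw [show 4 * k + 3 - 1 = 4 * k + 2 by omega, show (4 * k + 3 + 1) / 4 = k + 1 by omega]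
      ring
    rw [Zsqrtd.norm_natCast, Int.natAbs_mul, Int.natAbs_natCast]
    omega
  have hpow : φ α ^ (p - 1) = φ (star α) / φ α := by
    refine eq_div_of_mul_eq (hom_ne_zero φ hα) ?_
    rw [← pow_succ, Nat.sub_add_cancel hp.out.one_le, hom_pow_char_of_three φ h3]
  rw [quarticJacobiSymbol_of_irreducible α hpr.irreducible,
    ← hom_eq_of_dvd_sub φ (hom_natCast_char φ) hd, hn, map_pow, pow_mul, hpow]

theorem hom_quarticJacobiSymbol (h2 : p ≠ 2) (hα : ¬ (p : ℤ) ∣ α.norm) :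
    φ (quarticJacobiSymbol α p) = (φ α / φ (star α)) ^ ((pstar p - 1) / 4) := by
  rcases mod_four_of_prime hp.out h2 with h | h
  · rw [hom_quarticJacobiSymbol_of_one φ h hα, pstar_of_one h, ← zpow_natCast]
    congr 1
    omega
  · rw [hom_quarticJacobiSymbol_of_three φ h hα, pstar_of_three h, ← inv_div, inv_pow,
      ← zpow_natCast, ← zpow_neg]
    congr 1
    omega

theorem quarticJacobiSymbol_eq_of_hom (h2 : p ≠ 2) {u : GaussianInt} (hα : ¬ (p : ℤ) ∣ α.norm)
    (hu : IsUnit u) (h : φ u = (φ α / φ (star α)) ^ ((pstar p - 1) / 4)) :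
    quarticJacobiSymbol α p = u :=
  hom_injOn_units φ (Ring.two_ne_zero (by rwa [ringChar.eq R p]))
    (isUnit_quarticJacobiSymbol_natCast h2 hα) hu
    (by rw [hom_quarticJacobiSymbol φ h2 hα, h])

theorem hom_quarticJacobiSymbol_sq_mul_legendreSym (h2 : p ≠ 2) (hα : ¬ (p : ℤ) ∣ α.norm) :
    φ (quarticJacobiSymbol α p) ^ 2 * (legendreSym p α.norm : R) = 1 := by
  have hp0 : 2 ≤ p := hp.out.two_le
  have hα0 := hom_ne_zero φ (p := p) hα
  have hα0' := hom_star_ne_zero φ (p := p) hα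
  rw [intCast_legendreSym, ← hom_mul_star φ, mul_pow]
  rcases mod_four_of_prime hp.out h2 with h | h
  · have hpow : φ α ^ (p / 2) * φ α ^ (p / 2) = 1 := by
      refine mul_right_cancel₀ hα0 ?_
      rw [← pow_add, ← pow_succ, show p / 2 + p / 2 + 1 = p by omega,
        hom_pow_char_of_one φ h, one_mul]
    rw [hom_quarticJacobiSymbol_of_one φ h hα, ← pow_mul,
      show (p - 1) / 4 * 2 = p / 2 by omega, div_pow, ← hpow]
    field_simp
  · have hpow : φ (star α) ^ (p / 2 + 1) * φ (star α) ^ (p / 2) = φ α := by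
      rw [← pow_add, show p / 2 + 1 + p / 2 = p by omega, hom_pow_char_of_three φ h, star_star]
    rw [hom_quarticJacobiSymbol_of_three φ h hα, ← pow_mul,
      show (p + 1) / 4 * 2 = p / 2 + 1 by omega, div_pow, div_mul_eq_mul_div,
      div_eq_one_iff_eq (pow_ne_zero _ hα0), mul_left_comm, hpow, pow_succ]

end Hom

section SymbolOverRationalPrime

variable {p : ℕ} [hp : Fact p.Prime] {α : GaussianInt}

theorem exists_hom_algebraicClosure (p : ℕ) [Fact p.Prime] :
    Nonempty (GaussianInt →+* AlgebraicClosure (ZMod p)) := by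
  obtain ⟨r, hr⟩ := IsAlgClosed.exists_pow_nat_eq (-1 : AlgebraicClosure (ZMod p)) two_pos
  exact ⟨Zsqrtd.lift ⟨r, by rw [← sq, hr]; simp⟩⟩

theorem quarticJacobiSymbol_star (h2 : p ≠ 2) (hα : ¬ (p : ℤ) ∣ α.norm) :
    quarticJacobiSymbol (star α) p = star (quarticJacobiSymbol α p) := by
  obtain ⟨φ⟩ := exists_hom_algebraicClosure p
  have hs := isUnit_quarticJacobiSymbol_natCast h2 hα
  refine quarticJacobiSymbol_eq_of_hom φ h2 (by rwa [Zsqrtd.norm_conj]) hs.star ?_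
  rw [star_star, ← inv_div, inv_zpow, ← hom_quarticJacobiSymbol φ h2 hα]
  refine eq_inv_of_mul_eq_one_right ?_
  rw [← map_mul, mul_star_eq_one hs, map_one]

theorem quarticJacobiSymbol_of_eq_mul_star (h2 : p ≠ 2) (hα : ¬ (p : ℤ) ∣ α.norm)
    (w : GaussianIntˣ) (h : α = w * star α) :
    quarticJacobiSymbol α p = ↑(w ^ ((pstar p - 1) / 4)) := by
  obtain ⟨φ⟩ := exists_hom_algebraicClosure p
  refine quarticJacobiSymbol_eq_of_hom φ h2 hα (Units.isUnit _) ?_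
  have hquot : φ α / φ (star α) = φ w := by
    rw [div_eq_iff (hom_star_ne_zero φ hα), ← map_mul, ← h]
  rw [hquot]
  exact (congrArg Units.val (map_zpow (Units.map φ.toMonoidHom) w ((pstar p - 1) / 4))).trans
    (Units.val_zpow_eq_zpow_val _ _)

theorem quarticJacobiSymbol_intCast (h2 : p ≠ 2) {n : ℤ} (hn : ¬ (p : ℤ) ∣ n) :
    quarticJacobiSymbol n p = 1 := by
  have hnorm : ¬ (p : ℤ) ∣ (n : GaussianInt).norm := by
    rw [Zsqrtd.norm_intCast]
    exact fun h => hn ((Nat.prime_iff_prime_int.1 hp.out).dvd_or_dvd h |>.elim id id)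
  rw [quarticJacobiSymbol_of_eq_mul_star h2 hnorm 1 (by simp), one_zpow, Units.val_one]

theorem quarticJacobiSymbol_one_left (h2 : p ≠ 2) : quarticJacobiSymbol 1 p = 1 := by
  have h1 : ¬ (p : ℤ) ∣ 1 := by simpa using not_natCast_dvd_two_pow hp.out h2 0
  simpa using quarticJacobiSymbol_intCast h2 h1

theorem quarticJacobiSymbol_intCast_mul (h2 : p ≠ 2) {n : ℤ} (hn : ¬ (p : ℤ) ∣ n)
    (α : GaussianInt) : quarticJacobiSymbol (n * α) p = quarticJacobiSymbol α p := by
  rw [quarticJacobiSymbol_mul_left (odd_norm_natCast h2), quarticJacobiSymbol_intCast h2 hn,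
    one_mul]

theorem quarticJacobiSymbol_neg (h2 : p ≠ 2) (α : GaussianInt) :
    quarticJacobiSymbol (-α) p = quarticJacobiSymbol α p := by
  have h1 : ¬ (p : ℤ) ∣ -1 := by simpa using not_natCast_dvd_two_pow hp.out h2 0
  simpa using quarticJacobiSymbol_intCast_mul h2 h1 α

theorem quarticJacobiSymbol_gI (h2 : p ≠ 2) :
    quarticJacobiSymbol gI p = (legendreSym p 2 : GaussianInt) := by
  have hnorm : ¬ (p : ℤ) ∣ gI.norm := fun h =>
    hp.out.one_lt.ne' (by exact_mod_cast Int.eq_one_of_dvd_one (by positivity) h)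
  have hmod := hp.out.eq_two_or_odd.resolve_left h2
  rw [quarticJacobiSymbol_of_eq_mul_star h2 hnorm (-1) (by decide), legendreSym.at_two h2,
    ZMod.χ₈_nat_eq_if_mod_eight, if_neg (by omega)]
  rcases mod_four_of_prime hp.out h2 with h | h
  · rw [pstar_of_one h]
    split_ifs with h8
    · rw [Even.neg_one_zpow (Int.even_iff.2 (by omega))]; rfl
    · rw [Odd.neg_one_zpow (Int.odd_iff.2 (by omega))]; rfl
  · rw [pstar_of_three h]
    split_ifs with h8
    · rw [Even.neg_one_zpow (Int.even_iff.2 (by omega))]; rfl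
    · rw [Odd.neg_one_zpow (Int.odd_iff.2 (by omega))]; rfl

theorem quarticJacobiSymbol_sq (h2 : p ≠ 2) (hα : ¬ (p : ℤ) ∣ α.norm) :
    quarticJacobiSymbol α p ^ 2 = (legendreSym p α.norm : GaussianInt) := by
  obtain ⟨φ⟩ := exists_hom_algebraicClosure p
  have hmul := hom_quarticJacobiSymbol_sq_mul_legendreSym φ h2 hα
  have hleg : legendreSym p α.norm = 1 ∨ legendreSym p α.norm = -1 :=
    legendreSym.eq_one_or_neg_one p (by rwa [Ne, ZMod.intCast_zmod_eq_zero_iff_dvd])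
  refine hom_injOn_units φ (Ring.two_ne_zero (by rwa [ringChar.eq _ p]))
    ((isUnit_quarticJacobiSymbol_natCast h2 hα).pow 2) ?_ ?_
  · rcases hleg with h | h <;> simp [h]
  · rw [map_pow, map_intCast]
    rcases hleg with h | h <;> rw [h] at hmul ⊢
    · simpa using hmul
    · simpa [neg_eq_iff_eq_neg] using hmul

end SymbolOverRationalPrime

section Sums

theorem sum_range_eq_sum_even {R : Type*} [AddCommMonoid R] (f : ℕ → R)
    (hf : ∀ k, f (2 * k + 1) = 0) (n : ℕ) :
    ∑ j ∈ Finset.range (n + 1), f j = ∑ k ∈ Finset.range (n / 2 + 1), f (2 * k) := by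
  induction n with
  | zero => simp
  | succ n ih =>
    rw [Finset.sum_range_succ, ih]
    rcases Nat.even_or_odd' n with ⟨c, rfl | rfl⟩
    · rw [hf, add_zero, show (2 * c + 1) / 2 = 2 * c / 2 by omega]
    · rw [show (2 * c + 1 + 1) / 2 = (2 * c + 1) / 2 + 1 by omega,
        Finset.sum_range_succ _ ((2 * c + 1) / 2 + 1),
        show 2 * ((2 * c + 1) / 2 + 1) = 2 * c + 1 + 1 by omega]

theorem two_mul_sum_even_choose {R : Type*} [CommRing R] (y : R) (n : ℕ) :
    2 * ∑ k ∈ Finset.range (n / 2 + 1), (n.choose (2 * k) : R) * y ^ (2 * k) =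
      (1 + y) ^ n + (1 - y) ^ n := by
  rw [add_comm 1 y, show 1 - y = -y + 1 by ring, add_pow, add_pow, ← Finset.sum_add_distrib,
    sum_range_eq_sum_even (n := n), Finset.mul_sum]
  · refine Finset.sum_congr rfl fun k _ => ?_
    rw [(even_two_mul k).neg_pow]; ring
  · intro k
    rw [(odd_two_mul_add_one k).neg_pow]; ring

section CharP

variable {R : Type*} [Field R] (φ : GaussianInt →+* R) {p : ℕ} [hp : Fact p.Prime] [CharP R p]
  {α : GaussianInt}

theorem choose_two_mul_self (h2 : p ≠ 2) {j : ℕ} (hj : j ≤ p / 2) :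
    ((2 * j).choose j : R) = ((p / 2).choose j : R) * (-4) ^ j := by
  have hodd := hp.out.eq_two_or_odd
  induction j with
  | zero => simp
  | succ j ih =>
    have ih := ih (by omega)
    have hj0 : ((j + 1 : ℕ) : R) ≠ 0 := by
      rw [Ne, CharP.cast_eq_zero_iff R p]
      exact Nat.not_dvd_of_pos_of_lt (by omega) (by omega)
    have hcentral := congrArg (Nat.cast (R := R)) (Nat.succ_mul_centralBinom_succ j)
    have hchoose := congrArg (Nat.cast (R := R)) (Nat.choose_succ_right_eq (p / 2) j)
    rw [Nat.centralBinom_eq_two_mul_choose, Nat.centralBinom_eq_two_mul_choose] at hcentral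
    have hchar : ((2 * (p / 2) + 1 : ℕ) : R) = 0 := by
      rw [show 2 * (p / 2) + 1 = p by omega, CharP.cast_eq_zero]
    push_cast [Nat.cast_sub (show j ≤ p / 2 by omega)] at hcentral hchoose hchar hj0
    apply mul_left_cancel₀ hj0
    linear_combination hcentral + 2 * (2 * j + 1) * ih + 4 * (-4) ^ j * hchoose +
      2 * ((p / 2).choose j : R) * (-4) ^ j * hchar

theorem two_mul_binomSum (h2 : p ≠ 2) (ι : ZMod p →+* R) {x : ZMod p} {y : R}
    (hxy : 16 * ι x = y ^ 2) :
    2 * ι (binomSum p x) = (1 + y) ^ (p / 2) + (1 - y) ^ (p / 2) := by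
  rw [← two_mul_sum_even_choose, binomSum, map_sum, Nat.div_div_eq_div_mul]
  congr 1
  refine Finset.sum_congr rfl fun k hk => ?_
  rw [Finset.mem_range] at hk
  rw [map_mul, map_natCast, map_pow, show 4 * k = 2 * (2 * k) by ring,
    choose_two_mul_self h2 (by omega), pow_mul, pow_mul, ← hxy, mul_pow, mul_assoc]
  norm_num

theorem hom_add_hom_star (z : GaussianInt) : φ z + φ (star z) = 2 * z.re := by
  have h : z + star z = (2 * z.re : ℤ) := by ext <;> simp [two_mul]
  rw [← map_add, h, map_intCast]
  push_cast
  rfl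

theorem hom_sub_hom_star (z : GaussianInt) : φ z - φ (star z) = 2 * φ gI * z.im := by
  have h : z - star z = 2 * gI * z.im := by ext <;> simp [gI, two_mul]
  rw [← map_sub, h, map_mul, map_mul, map_intCast, map_ofNat]

theorem two_mul_hom_legendreSym_mul_binomSum (h2 : p ≠ 2) (ι : ZMod p →+* R)
    (hre : ¬ (p : ℤ) ∣ α.re) :
    2 * ι (legendreSym p α.re * binomSum p (-(α.im / (4 * α.re)) ^ 2)) =
      φ α ^ (p / 2) + φ (star α) ^ (p / 2) := by
  have h20 : (2 : R) ≠ 0 := Ring.two_ne_zero (by rwa [ringChar.eq R p])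
  have h40 : (4 : R) ≠ 0 := by convert mul_ne_zero h20 h20; norm_num
  have hre0 : (α.re : R) ≠ 0 := by rwa [Ne, CharP.intCast_eq_zero_iff R p]
  have hi : φ gI * φ gI = -1 := by rw [← map_mul, gI_mul_gI, map_neg, map_one]
  have hy : 16 * ι (-(α.im / (4 * α.re)) ^ 2) = (φ gI * α.im / α.re) ^ 2 := by
    simp only [map_neg, map_pow, map_div₀, map_mul, map_intCast, map_ofNat]
    field_simp
    linear_combination -(16 * α.im ^ 2 : R) * hi
  have hadd : φ α = α.re * (1 + φ gI * α.im / α.re) := by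
    rw [mul_add, mul_div_cancel₀ _ hre0]
    refine mul_left_cancel₀ h20 ?_
    linear_combination hom_add_hom_star φ α + hom_sub_hom_star φ α
  have hsub : φ (star α) = α.re * (1 - φ gI * α.im / α.re) := by
    rw [mul_sub, mul_div_cancel₀ _ hre0]
    refine mul_left_cancel₀ h20 ?_
    linear_combination hom_add_hom_star φ α - hom_sub_hom_star φ α
  rw [map_mul, mul_left_comm, two_mul_binomSum h2 ι hy, map_intCast, intCast_legendreSym, mul_add,
    ← mul_pow, ← mul_pow, ← hadd, ← hsub]

theorem hom_pow_half_of_one (h1 : p % 4 = 1) (hα : ¬ (p : ℤ) ∣ α.norm) :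
    φ α ^ (p / 2) = φ (quarticJacobiSymbol α p) * (α.norm : R) ^ ((p - 1) / 4) := by
  have h0 := hom_star_ne_zero φ (p := p) hα
  rw [hom_quarticJacobiSymbol_of_one φ h1 hα, ← hom_mul_star φ, ← mul_pow,
    show p / 2 = 2 * ((p - 1) / 4) by omega, pow_mul]
  congr 1
  field_simp

theorem hom_star_pow_half_of_three (h3 : p % 4 = 3) (hα : ¬ (p : ℤ) ∣ α.norm) :
    φ (star α) ^ (p / 2) = φ (quarticJacobiSymbol α p * α) * (α.norm : R) ^ ((p - 3) / 4) := by
  have h0 := hom_ne_zero φ (p := p) hα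
  rw [map_mul, hom_quarticJacobiSymbol_of_three φ h3 hα, ← hom_mul_star φ,
    show p / 2 = 2 * ((p - 3) / 4) + 1 by omega, show (p + 1) / 4 = (p - 3) / 4 + 1 by omega]
  rw [div_pow, mul_pow]
  field_simp
  ring

end CharP

variable {p : ℕ} [hp : Fact p.Prime] {α : GaussianInt}

theorem legendreSym_re_mul_binomSum_of_one (h1 : p % 4 = 1) (hre : ¬ (p : ℤ) ∣ α.re)
    (hα : ¬ (p : ℤ) ∣ α.norm) :
    legendreSym p α.re * binomSum p (-(α.im / (4 * α.re)) ^ 2) =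
      (((quarticJacobiSymbol α p).re * α.norm ^ ((p - 1) / 4) : ℤ) : ZMod p) := by
  obtain ⟨φ⟩ := exists_hom_algebraicClosure p
  have h2 : p ≠ 2 := by omega
  have hstar := hom_pow_half_of_one φ h1 (α := star α) (by rwa [Zsqrtd.norm_conj])
  rw [quarticJacobiSymbol_star h2 hα, Zsqrtd.norm_conj] at hstar
  apply (algebraMap (ZMod p) (AlgebraicClosure (ZMod p))).injective
  refine mul_left_cancel₀ (Ring.two_ne_zero (by rwa [ringChar.eq _ p])) ?_
  rw [two_mul_hom_legendreSym_mul_binomSum φ h2 _ hre, hom_pow_half_of_one φ h1 hα, hstar,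
    ← add_mul, hom_add_hom_star, map_intCast]
  push_cast
  ring

theorem legendreSym_re_mul_binomSum_of_three (h3 : p % 4 = 3) (hre : ¬ (p : ℤ) ∣ α.re)
    (hα : ¬ (p : ℤ) ∣ α.norm) :
    legendreSym p α.re * binomSum p (-(α.im / (4 * α.re)) ^ 2) =
      (((quarticJacobiSymbol α p * α).re * α.norm ^ ((p - 3) / 4) : ℤ) : ZMod p) := by
  obtain ⟨φ⟩ := exists_hom_algebraicClosure p
  have h2 : p ≠ 2 := by omega
  have hstar := hom_star_pow_half_of_three φ h3 (α := star α) (by rwa [Zsqrtd.norm_conj])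
  rw [quarticJacobiSymbol_star h2 hα, Zsqrtd.norm_conj, ← star_mul', star_star] at hstar
  apply (algebraMap (ZMod p) (AlgebraicClosure (ZMod p))).injective
  refine mul_left_cancel₀ (Ring.two_ne_zero (by rwa [ringChar.eq _ p])) ?_
  rw [two_mul_hom_legendreSym_mul_binomSum φ h2 _ hre, hom_star_pow_half_of_three φ h3 hα, hstar,
    add_comm, ← add_mul, hom_add_hom_star, map_intCast]
  push_cast
  ring

theorem gI_mul_star (z : GaussianInt) : gI * star z = ⟨z.im, z.re⟩ := by
  ext <;> simp [gI]

theorem norm_gI_mul_star (z : GaussianInt) : (gI * star z).norm = z.norm := by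
  rw [gI_mul_star, norm_eq, norm_eq, add_comm]

theorem quarticJacobiSymbol_gI_mul_star (h2 : p ≠ 2) (hα : ¬ (p : ℤ) ∣ α.norm) :
    quarticJacobiSymbol (gI * star α) p =
      (legendreSym p 2 : GaussianInt) * star (quarticJacobiSymbol α p) := by
  rw [quarticJacobiSymbol_mul_left (odd_norm_natCast h2), quarticJacobiSymbol_gI h2,
    quarticJacobiSymbol_star h2 hα]

theorem legendreSym_two_mul_self (h2 : p ≠ 2) : legendreSym p 2 * legendreSym p 2 = 1 := by
  rw [← sq]
  refine legendreSym.sq_one p ?_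
  exact_mod_cast Ring.two_ne_zero (by rwa [ZMod.ringChar_zmod_n])

theorem legendreSym_im_mul_binomSum_of_one (h1 : p % 4 = 1) (him : ¬ (p : ℤ) ∣ α.im)
    (hα : ¬ (p : ℤ) ∣ α.norm) :
    legendreSym p (2 * α.im) * binomSum p (-(α.re / (4 * α.im)) ^ 2) =
      (((quarticJacobiSymbol α p).re * α.norm ^ ((p - 1) / 4) : ℤ) : ZMod p) := by
  have h := legendreSym_re_mul_binomSum_of_one h1 (α := gI * star α) (by rwa [gI_mul_star])
    (by rwa [norm_gI_mul_star])
  rw [quarticJacobiSymbol_gI_mul_star (by omega) hα, norm_gI_mul_star, gI_mul_star] at h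
  rw [legendreSym.mul, Int.cast_mul, mul_assoc, h, ← Int.cast_mul]
  congr 1
  rw [Zsqrtd.re_smul, Zsqrtd.re_star]
  linear_combination ((quarticJacobiSymbol α p).re * α.norm ^ ((p - 1) / 4)) *
    legendreSym_two_mul_self (p := p) (by omega)

theorem legendreSym_im_mul_binomSum_of_three (h3 : p % 4 = 3) (him : ¬ (p : ℤ) ∣ α.im)
    (hα : ¬ (p : ℤ) ∣ α.norm) :
    legendreSym p (2 * α.im) * binomSum p (-(α.re / (4 * α.im)) ^ 2) =
      (((quarticJacobiSymbol α p * α).im * α.norm ^ ((p - 3) / 4) : ℤ) : ZMod p) := by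
  have h := legendreSym_re_mul_binomSum_of_three h3 (α := gI * star α) (by rwa [gI_mul_star])
    (by rwa [norm_gI_mul_star])
  rw [quarticJacobiSymbol_gI_mul_star (by omega) hα, norm_gI_mul_star, gI_mul_star] at h
  rw [legendreSym.mul, Int.cast_mul, mul_assoc, h, ← Int.cast_mul]
  congr 1
  rw [mul_assoc, Zsqrtd.re_smul, Zsqrtd.re_mul, Zsqrtd.re_star, Zsqrtd.im_star, Zsqrtd.im_mul]
  linear_combination ((quarticJacobiSymbol α p).re * α.im + (quarticJacobiSymbol α p).im * α.re) *
    α.norm ^ ((p - 3) / 4) * legendreSym_two_mul_self (p := p) (by omega)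

end Sums

section Sign

theorem norm_mk (b m : ℤ) : (⟨b, 2 * m⟩ : GaussianInt).norm = b ^ 2 + 4 * m ^ 2 := by
  rw [norm_eq]
  ring

/-- The sign `δ_p` of the theorem, read off the symbol `s = (b + 2mi / p)₄`: it is `s` if
`s = ± 1` and `s * i` if `s = ± i`. -/
noncomputable def quarticSign (b m : ℤ) (p : ℕ) : ℤ :=
  (quarticJacobiSymbol ⟨b, 2 * m⟩ p).re - (quarticJacobiSymbol ⟨b, 2 * m⟩ p).im

variable {b m : ℤ} {p : ℕ} [hp : Fact p.Prime]

theorem quarticSign_eq_one_or_neg_one (h2 : p ≠ 2) (hD : ¬ (p : ℤ) ∣ b ^ 2 + 4 * m ^ 2) :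
    quarticSign b m p = 1 ∨ quarticSign b m p = -1 := by
  have hs : IsUnit (quarticJacobiSymbol ⟨b, 2 * m⟩ p) :=
    isUnit_quarticJacobiSymbol_natCast h2 (by rwa [norm_mk])
  rw [quarticSign]
  rcases isUnit_iff.1 hs with h | h | h | h <;> simp [h, gI]

theorem intCast_quarticSign_of_legendreSym_eq_one (h2 : p ≠ 2)
    (hD : ¬ (p : ℤ) ∣ b ^ 2 + 4 * m ^ 2) (hl : legendreSym p (b ^ 2 + 4 * m ^ 2) = 1) :
    (quarticSign b m p : GaussianInt) = quarticJacobiSymbol ⟨b, 2 * m⟩ p := by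
  have hsq := quarticJacobiSymbol_sq (α := ⟨b, 2 * m⟩) h2 (by rwa [norm_mk])
  rw [norm_mk, hl, Int.cast_one, sq_eq_one_iff] at hsq
  rw [quarticSign]
  rcases hsq with h | h <;> simp [h]

theorem intCast_quarticSign_of_legendreSym_eq_neg_one (h2 : p ≠ 2)
    (hD : ¬ (p : ℤ) ∣ b ^ 2 + 4 * m ^ 2) (hl : legendreSym p (b ^ 2 + 4 * m ^ 2) = -1) :
    (quarticSign b m p : GaussianInt) = quarticJacobiSymbol ⟨b, 2 * m⟩ p * gI := by
  have hsq := quarticJacobiSymbol_sq (α := ⟨b, 2 * m⟩) h2 (by rwa [norm_mk])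
  rw [norm_mk, hl, Int.cast_neg, Int.cast_one, ← gI_mul_gI, ← sq, sq_eq_sq_iff_eq_or_eq_neg] at hsq
  rw [quarticSign]
  rcases hsq with h | h <;> simp [h, gI_mul_gI] <;> simp [gI]

theorem legendreSym_two_mul_two_mul (h2 : p ≠ 2) (a : ℤ) :
    legendreSym p (2 * (2 * a)) = legendreSym p a := by
  rw [legendreSym.mul, legendreSym.mul, ← mul_assoc, legendreSym_two_mul_self h2, one_mul]

theorem two_mul_div_four_mul_sq {K : Type*} [Field K] (h2 : (2 : K) ≠ 0) (x y : K) :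
    (2 * x / (4 * y)) ^ 2 = x ^ 2 / (4 * y ^ 2) := by
  rw [show 4 * y = 2 * (2 * y) by ring, mul_div_mul_left _ _ h2, div_pow]
  congr 1
  ring

theorem sumCongruences_of_quarticJacobiSymbol (h2 : p ≠ 2) (hb : ¬ (p : ℤ) ∣ b)
    (hm : ¬ (p : ℤ) ∣ m) (hD : ¬ (p : ℤ) ∣ b ^ 2 + 4 * m ^ 2) {δ : ℤ}
    (hpos : legendreSym p (b ^ 2 + 4 * m ^ 2) = 1 →
      (δ : GaussianInt) = quarticJacobiSymbol ⟨b, 2 * m⟩ p)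
    (hneg : legendreSym p (b ^ 2 + 4 * m ^ 2) = -1 →
      (δ : GaussianInt) = quarticJacobiSymbol ⟨b, 2 * m⟩ p * gI) :
    SumCongruences b m p δ := by
  have h20 : (2 : ZMod p) ≠ 0 := Ring.two_ne_zero (by rwa [ZMod.ringChar_zmod_n])
  have hm2 : ¬ (p : ℤ) ∣ 2 * m := by
    rw [← ZMod.intCast_zmod_eq_zero_iff_dvd] at hm ⊢
    push_cast
    exact mul_ne_zero h20 hm
  have hN : ¬ (p : ℤ) ∣ (⟨b, 2 * m⟩ : GaussianInt).norm := by rwa [norm_mk]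
  have hfirst : -((m : ZMod p) ^ 2 / (4 * (b : ZMod p) ^ 2)) =
      -(((2 * m : ℤ) : ZMod p) / (4 * (b : ZMod p))) ^ 2 := by
    rw [Int.cast_mul, Int.cast_ofNat, two_mul_div_four_mul_sq h20]
  have hsecond : -((b : ZMod p) ^ 2 / (64 * (m : ZMod p) ^ 2)) =
      -((b : ZMod p) / (4 * ((2 * m : ℤ) : ZMod p))) ^ 2 := by
    rw [Int.cast_mul, Int.cast_ofNat, div_pow]
    congr 2
    ring
  have hsneg : legendreSym p (b ^ 2 + 4 * m ^ 2) = -1 →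
      quarticJacobiSymbol ⟨b, 2 * m⟩ p = ⟨0, -δ⟩ := fun hl => by
    have : quarticJacobiSymbol ⟨b, 2 * m⟩ p = -gI * δ := by
      linear_combination quarticJacobiSymbol ⟨b, 2 * m⟩ p * gI_mul_gI + gI * hneg hl
    rw [this]
    ext <;> simp [gI]
  simp only [SumCongruences, hfirst, hsecond, ← legendreSym_two_mul_two_mul h2 m,
    ← norm_mk]
  simp only [← norm_mk] at hpos hsneg
  refine ⟨fun h1 hl => ?_, fun h3 hl => ?_, fun h1 hl => ?_, fun h3 hl => ?_⟩
  · rw [legendreSym_re_mul_binomSum_of_one h1 hb hN, legendreSym_im_mul_binomSum_of_one h1 hm2 hN,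
      ← hpos hl, Zsqrtd.re_intCast]
    exact ⟨rfl, rfl⟩
  · rw [legendreSym_re_mul_binomSum_of_three h3 hb hN,
      legendreSym_im_mul_binomSum_of_three h3 hm2 hN, ← hpos hl, Zsqrtd.re_smul, Zsqrtd.im_smul,
      mul_comm δ, mul_comm δ]
    exact ⟨rfl, rfl⟩
  · rw [legendreSym_re_mul_binomSum_of_one h1 hb hN, legendreSym_im_mul_binomSum_of_one h1 hm2 hN,
      hsneg hl, zero_mul, Int.cast_zero]
    exact ⟨rfl, rfl⟩
  · rw [legendreSym_re_mul_binomSum_of_three h3 hb hN,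
      legendreSym_im_mul_binomSum_of_three h3 hm2 hN, hsneg hl, Zsqrtd.re_mul, Zsqrtd.im_mul]
    constructor <;> congr 1 <;> ring

theorem sign_eq_of_intCast_mul_eq (h2 : p ≠ 2) {x ε δ : ℤ} (hx : ¬ (p : ℤ) ∣ x)
    (hε : ε = 1 ∨ ε = -1) (hδ : δ = 1 ∨ δ = -1)
    (h : ((x * ε : ℤ) : ZMod p) = ((x * δ : ℤ) : ZMod p)) : ε = δ := by
  have hx0 : (x : ZMod p) ≠ 0 := by rwa [Ne, ZMod.intCast_zmod_eq_zero_iff_dvd]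
  rw [Int.cast_mul, Int.cast_mul] at h
  exact Int.cast_injOn_of_ringChar_ne_two (by rwa [ZMod.ringChar_zmod_n]) (Or.inr hε)
    (Or.inr hδ) (mul_left_cancel₀ hx0 h)

theorem sign_eq_of_sumCongruences (h2 : p ≠ 2) (hb : ¬ (p : ℤ) ∣ b) (hm : ¬ (p : ℤ) ∣ m)
    (hD : ¬ (p : ℤ) ∣ b ^ 2 + 4 * m ^ 2)
    (hne : ¬ (p % 4 = 1 ∧ legendreSym p (b ^ 2 + 4 * m ^ 2) = -1)) {δ ε : ℤ}
    (hδ : δ = 1 ∨ δ = -1) (hε : ε = 1 ∨ ε = -1) (hSδ : SumCongruences b m p δ)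
    (hSε : SumCongruences b m p ε) : ε = δ := by
  have hpr : Prime (p : ℤ) := Nat.prime_iff_prime_int.1 hp.out
  have hDn (n : ℕ) : ¬ (p : ℤ) ∣ (b ^ 2 + 4 * m ^ 2) ^ n := fun h => hD (hpr.dvd_of_dvd_pow h)
  have hp2 : ¬ (p : ℤ) ∣ 2 := by simpa using not_natCast_dvd_two_pow hp.out h2 1
  have hl : legendreSym p (b ^ 2 + 4 * m ^ 2) = 1 ∨ legendreSym p (b ^ 2 + 4 * m ^ 2) = -1 :=
    legendreSym.eq_one_or_neg_one p (by rwa [Ne, ZMod.intCast_zmod_eq_zero_iff_dvd])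
  rcases mod_four_of_prime hp.out h2 with h4 | h4 <;> rcases hl with hl | hl
  · refine sign_eq_of_intCast_mul_eq h2 (hDn ((p - 1) / 4)) hε hδ ?_
    rw [mul_comm, mul_comm _ δ, ← (hSδ.1 h4 hl).1, ← (hSε.1 h4 hl).1]
  · exact absurd ⟨h4, hl⟩ hne
  · refine sign_eq_of_intCast_mul_eq h2 (hpr.not_dvd_mul hb (hDn ((p - 3) / 4))) hε hδ ?_
    rw [mul_right_comm, mul_right_comm _ _ δ, ← (hSδ.2.1 h4 hl).1, ← (hSε.2.1 h4 hl).1]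
  · refine sign_eq_of_intCast_mul_eq h2
      (hpr.not_dvd_mul (hpr.not_dvd_mul hp2 hm) (hDn ((p - 3) / 4))) hε hδ ?_
    rw [mul_right_comm, mul_right_comm _ _ δ, ← (hSδ.2.2.2 h4 hl).1, ← (hSε.2.2.2 h4 hl).1]

end Sign

section Primary

/-- A Gaussian integer is primary if it is congruent to `1` modulo `2 + 2i`; this singles out one
of the four associates of every Gaussian integer of odd norm. -/
def IsPrimary (z : GaussianInt) : Prop := 2 * (1 + gI) ∣ z - 1

theorem isPrimary_iff {z : GaussianInt} : IsPrimary z ↔ 2 ∣ z.im ∧ 4 ∣ z.re + z.im - 1 := by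
  have hmul (c : GaussianInt) : 2 * (1 + gI) * c = ⟨2 * (c.re - c.im), 2 * (c.re + c.im)⟩ := by
    ext <;> simp [gI] <;> ring
  constructor
  · rintro ⟨c, hc⟩
    have hre : z.re - 1 = 2 * (c.re - c.im) := congrArg Zsqrtd.re (hc.trans (hmul c))
    have him : z.im - 0 = 2 * (c.re + c.im) := congrArg Zsqrtd.im (hc.trans (hmul c))
    omega
  · rintro ⟨⟨x, hx⟩, ⟨y, hy⟩⟩
    refine ⟨⟨y, x - y⟩, (Zsqrtd.ext ?_ ?_ : z - 1 = ⟨_, _⟩).trans (hmul _).symm⟩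
    · rw [Zsqrtd.re_sub, Zsqrtd.re_one]
      linarith
    · rw [Zsqrtd.im_sub, Zsqrtd.im_one]
      linarith

theorem isPrimary_one : IsPrimary 1 := by simp [IsPrimary]

theorem IsPrimary.mul {z w : GaussianInt} (hz : IsPrimary z) (hw : IsPrimary w) :
    IsPrimary (z * w) := by
  simpa only [IsPrimary, mul_one] using dvd_mul_sub_mul hz hw

theorem IsPrimary.of_mul_right {z w : GaussianInt} (hz : IsPrimary z) (hw : IsPrimary (w * z)) :
    IsPrimary w := by
  have h : w - 1 = (w * z - 1) - w * (z - 1) := by ring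
  rw [IsPrimary, h]
  exact dvd_sub hw (hz.mul_left _)

theorem IsPrimary.eq_one_of_isUnit {u : GaussianInt} (h : IsPrimary u) (hu : IsUnit u) :
    u = 1 := by
  rw [isPrimary_iff] at h
  rcases isUnit_iff.1 hu with rfl | rfl | rfl | rfl
  · rfl
  all_goals revert h; decide

theorem IsPrimary.eq_of_associated {π γ : GaussianInt} (hπ : IsPrimary π) (hγ : IsPrimary γ)
    (h : Associated γ π) : π = γ := by
  obtain ⟨u, rfl⟩ := h
  rw [mul_comm] at hπ ⊢
  rw [(hγ.of_mul_right hπ).eq_one_of_isUnit u.isUnit, one_mul]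

theorem IsPrimary.odd_norm {z : GaussianInt} (h : IsPrimary z) : Odd z.norm := by
  obtain ⟨⟨x, hx⟩, ⟨y, hy⟩⟩ := isPrimary_iff.1 h
  rw [norm_eq, hx, show z.re = 4 * y - 2 * x + 1 by omega]
  exact ⟨2 * (2 * y - x) ^ 2 + 2 * (2 * y - x) + 2 * x ^ 2, by ring⟩

theorem exists_isPrimary_mul {z : GaussianInt} (hz : Odd z.norm) :
    ∃ u, IsUnit u ∧ IsPrimary (u * z) := by
  have hodd : (z.re + z.im) % 2 = 1 := by
    rw [norm_eq, sq, sq, Int.odd_add', Int.odd_mul, Int.even_mul, or_self, and_self] at hz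
    exact Int.odd_iff.1 (Int.odd_add'.2 hz)
  rcases Int.even_or_odd z.im with him | him
  · have him := Int.even_iff.1 him
    rcases (by omega : (z.re + z.im) % 4 = 1 ∨ (z.re + z.im) % 4 = 3) with h | h
    · exact ⟨1, isUnit_one, isPrimary_iff.2 ⟨by simp; omega, by simp; omega⟩⟩
    · exact ⟨-1, isUnit_one.neg, isPrimary_iff.2 ⟨by simp; omega, by simp; omega⟩⟩
  · have him := Int.odd_iff.1 him
    rcases (by omega : (z.re - z.im) % 4 = 1 ∨ (z.re - z.im) % 4 = 3) with h | h
    · exact ⟨gI, isUnit_gI, isPrimary_iff.2 ⟨by simp [gI]; omega, by simp [gI]; omega⟩⟩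
    · exact ⟨-gI, isUnit_gI.neg, isPrimary_iff.2 ⟨by simp [gI]; omega, by simp [gI]; omega⟩⟩

theorem isPrimary_pstar {p : ℕ} (hp : p.Prime) (h2 : p ≠ 2) :
    IsPrimary (pstar p : GaussianInt) := by
  simpa [isPrimary_iff] using (pstar_modEq_one hp h2).symm.dvd

theorem odd_norm_of_not_dvd {z : GaussianInt} (h : ¬ 1 + gI ∣ z) : Odd z.norm := by
  by_contra hz
  rw [Int.not_odd_iff_even, norm_eq, Int.even_add, Int.even_pow' two_ne_zero,
    Int.even_pow' two_ne_zero, ← Int.even_add] at hz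
  obtain ⟨c, hc⟩ := hz
  refine h ⟨⟨c, c - z.re⟩, Zsqrtd.ext ?_ ?_⟩
  · simp only [gI, Zsqrtd.re_mul, Zsqrtd.re_add, Zsqrtd.im_add, Zsqrtd.re_one, Zsqrtd.im_one]
    ring
  · simp only [gI, Zsqrtd.im_mul, Zsqrtd.re_add, Zsqrtd.im_add, Zsqrtd.re_one, Zsqrtd.im_one]
    linarith

theorem exists_eq_mul_isPrimary {β : GaussianInt} (hβ : β ≠ 0) :
    ∃ (k : ℕ) (η γ : GaussianInt) (w : GaussianIntˣ), β = η * γ ∧ IsPrimary γ ∧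
      η.norm = 2 ^ k ∧ η = w * star η ∧ w ^ (2 * 2 ^ k) = 1 := by
  have hnorm : Zsqrtd.norm (1 + gI) = 2 := by decide
  have hirr : Irreducible (1 + gI) := irreducible_of_norm_prime Nat.prime_two hnorm
  obtain ⟨k, c, hc, rfl⟩ := WfDvdMonoid.max_power_factor hβ hirr
  obtain ⟨u, hu, hγ⟩ := exists_isPrimary_mul (odd_norm_of_not_dvd hc)
  obtain ⟨i, hi⟩ := isUnit_gI
  obtain ⟨v, hv⟩ := hu.star
  have huv : u * v = 1 := by rw [hv, mul_star_eq_one hu]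
  have hi2 : i ^ 2 = -1 := Units.ext (by rw [Units.val_pow_eq_pow_val, hi, sq, gI_mul_gI]; rfl)
  have hv4 : v ^ 4 = 1 :=
    Units.ext (by rw [Units.val_pow_eq_pow_val, pow_four_eq_one v.isUnit, Units.val_one])
  refine ⟨k, (1 + gI) ^ k * v, u * c, i ^ k * v ^ 2, ?_, hγ, ?_, ?_, ?_⟩
  · linear_combination -(1 + gI) ^ k * c * huv
  · rw [Zsqrtd.norm_mul, (Zsqrtd.norm_eq_one_iff' (by norm_num) _).2 v.isUnit, mul_one]
    exact (map_pow Zsqrtd.normMonoidHom (1 + gI) k).trans (congrArg (· ^ k) hnorm)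
  · have hstar : gI * star (1 + gI) = 1 + gI := by decide
    have hpow : (1 + gI) ^ k = gI ^ k * star (1 + gI) ^ k := by rw [← mul_pow, hstar]
    rw [star_mul, star_pow, hv, star_star, Units.val_mul, Units.val_pow_eq_pow_val,
      Units.val_pow_eq_pow_val, hi, ← hv]
    linear_combination (v : GaussianInt) * hpow - gI ^ k * star (1 + gI) ^ k * v * huv
  · rw [pow_mul, mul_pow, ← pow_mul, ← pow_mul, mul_comm k, pow_mul, hi2, hv4, mul_one, ← pow_mul]
    exact Even.neg_one_pow (Nat.even_mul.2 (by cases k <;> simp [Nat.even_pow]))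

theorem isPrimary_mk_or_isPrimary_neg {b : ℤ} (hb : Odd b) (m : ℤ) :
    IsPrimary ⟨b, 2 * m⟩ ∨ IsPrimary (-⟨b, 2 * m⟩) := by
  obtain ⟨c, rfl⟩ := hb
  rw [isPrimary_iff, isPrimary_iff, Zsqrtd.re_neg, Zsqrtd.im_neg]
  dsimp only
  omega

end Primary

section CharacterSums

open Polynomial in
theorem sum_eval_eq_zero {K : Type*} [Field K] [Fintype K] (P : K[X])
    (hP : P.natDegree < Fintype.card K - 1) : ∑ x : K, P.eval x = 0 := by
  simp_rw [eval_eq_sum_range]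
  rw [Finset.sum_comm]
  refine Finset.sum_eq_zero fun i hi => ?_
  rw [← Finset.mul_sum, FiniteField.sum_pow_lt_card_sub_one, mul_zero]
  rw [Finset.mem_range] at hi
  omega

variable {F : Type*} [Field F]

theorem mulChar_inv_eq_star (χ : MulChar F GaussianInt) :
    χ⁻¹ = χ.ringHomComp (starRingEnd GaussianInt) := by
  refine MulChar.ext fun a => ?_
  have hu : IsUnit (χ a) := a.isUnit.map χ
  rw [MulChar.inv_apply_eq_inv, MulChar.ringHomComp_apply, starRingEnd_apply]
  apply hu.mul_left_cancel
  rw [Ring.mul_inverse_cancel _ hu, mul_star_eq_one hu]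

theorem mulChar_pow_four (χ : MulChar F GaussianInt) : χ ^ 4 = 1 := by
  refine MulChar.ext fun a => ?_
  rw [MulChar.pow_apply_coe, MulChar.one_apply_coe, pow_four_eq_one (a.isUnit.map χ)]

theorem ringHomComp_ne_one {R : Type*} [Field R] (φ : GaussianInt →+* R) (h2 : (2 : R) ≠ 0)
    {χ : MulChar F GaussianInt} (hχ : χ ≠ 1) : χ.ringHomComp φ ≠ 1 := by
  obtain ⟨a, ha⟩ := MulChar.ne_one_iff.1 hχ
  refine MulChar.ne_one_iff.2 ⟨a, fun h => ha ?_⟩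
  exact hom_injOn_units φ h2 (a.isUnit.map χ) isUnit_one (by rwa [map_one])

variable [Fintype F]

theorem norm_jacobiSum {χ ρ : MulChar F GaussianInt} (hF : ringChar F ≠ 0) (hχ : χ ≠ 1)
    (hρ : ρ ≠ 1) (hχρ : χ * ρ ≠ 1) : (jacobiSum χ ρ).norm = Fintype.card F := by
  have hinj := GaussianInt.toComplex_injective
  have h := jacobiSum_mul_jacobiSum_inv (F' := ℂ) (χ := χ.ringHomComp GaussianInt.toComplex)
    (φ := ρ.ringHomComp GaussianInt.toComplex)
    (by rw [ringChar.eq_zero]; exact hF.symm)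
    ((MulChar.ringHomComp_ne_one_iff hinj).mpr hχ)
    ((MulChar.ringHomComp_ne_one_iff hinj).mpr hρ)
    (by rw [← MulChar.ringHomComp_mul]; exact (MulChar.ringHomComp_ne_one_iff hinj).mpr hχρ)
  rw [MulChar.ringHomComp_inv, MulChar.ringHomComp_inv, jacobiSum_ringHomComp,
    jacobiSum_ringHomComp, mulChar_inv_eq_star, mulChar_inv_eq_star, jacobiSum_ringHomComp,
    starRingEnd_apply, ← map_mul, ← Zsqrtd.norm_eq_mul_conj, ← map_natCast GaussianInt.toComplex]
    at h
  exact_mod_cast hinj h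

theorem one_add_gI_dvd_sub_one {u : GaussianInt} (hu : IsUnit u) : 1 + gI ∣ u - 1 := by
  rcases isUnit_iff.1 hu with rfl | rfl | rfl | rfl
  · simp
  · exact ⟨gI, by decide⟩
  · exact ⟨gI - 1, by decide⟩
  · exact ⟨-1, by decide⟩

theorem two_dvd_sq_sub_one {u : GaussianInt} (hu : IsUnit u) : 2 ∣ u ^ 2 - 1 := by
  rcases isUnit_iff.1 hu with rfl | rfl | rfl | rfl
  · simp
  · exact ⟨-1, by decide⟩
  · simp
  · exact ⟨-1, by decide⟩

theorem dvd_jacobiSum_add_card {χ : MulChar F GaussianInt} (hχ : χ ^ 2 ≠ 1) :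
    2 * (1 + gI) ∣ jacobiSum χ (χ ^ 2) + Fintype.card F := by
  have hχ1 : χ ≠ 1 := fun h => hχ (by rw [h, one_pow])
  have hsum : jacobiSum χ (χ ^ 2) + Fintype.card F =
      ∑ t, (χ t - 1) * ((χ ^ 2) (1 - t) - 1) := by
    have hsum₁ : ∑ t, χ t = 0 := MulChar.sum_eq_zero_of_ne_one hχ1
    have hsum₂ : ∑ t, (χ ^ 2) (1 - t) = 0 := by
      rw [← MulChar.sum_eq_zero_of_ne_one hχ, ← (Equiv.subLeft (1 : F)).sum_comp]
      simp only [Equiv.subLeft_apply, sub_sub_cancel]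
    have hterm (t : F) : (χ t - 1) * ((χ ^ 2) (1 - t) - 1) =
        χ t * (χ ^ 2) (1 - t) - χ t - (χ ^ 2) (1 - t) + 1 := by ring
    simp_rw [hterm]
    rw [Finset.sum_add_distrib, Finset.sum_sub_distrib, Finset.sum_sub_distrib, hsum₁, hsum₂,
      jacobiSum, sub_zero, sub_zero, Finset.sum_const, nsmul_one,
      Finset.card_univ]
  rw [hsum]
  refine Finset.dvd_sum fun t _ => ?_
  rcases eq_or_ne t 0 with rfl | ht
  · simp
  rcases eq_or_ne t 1 with rfl | ht1
  · simp
  have hs : (1 - t : F) ≠ 0 := sub_ne_zero.2 ht1.symm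
  rw [MulChar.pow_apply' _ two_ne_zero, mul_comm 2]
  exact mul_dvd_mul (one_add_gI_dvd_sub_one ((isUnit_iff_ne_zero.2 ht).map χ))
    (two_dvd_sq_sub_one ((isUnit_iff_ne_zero.2 hs).map χ))

end CharacterSums

section QuarticCharacter

variable {q : ℕ} [hq : Fact q.Prime] {π : GaussianInt}

theorem dvd_intCast_iff (hπ : π.norm = q) {n : ℤ} : π ∣ (n : GaussianInt) ↔ (n : ZMod q) = 0 := by
  rw [ZMod.intCast_zmod_eq_zero_iff_dvd]
  constructor
  · intro h
    have hn := norm_dvd_norm h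
    rw [hπ, Zsqrtd.norm_intCast] at hn
    exact (Nat.prime_iff_prime_int.1 hq.out).dvd_or_dvd hn |>.elim id id
  · rintro ⟨c, rfl⟩
    rw [← hπ, Int.cast_mul, Zsqrtd.norm_eq_mul_conj, mul_assoc]
    exact dvd_mul_right _ _

theorem quarticResidueSymbol_val_intCast (hπ : π.norm = q) (a : ℤ) :
    quarticResidueSymbol ((a : ZMod q).val) π = quarticResidueSymbol a π := by
  refine quarticResidueSymbol_congr ?_
  have h : π ∣ ((((a : ZMod q).val : ℤ) - a : ℤ) : GaussianInt) := by
    rw [dvd_intCast_iff hπ, Int.cast_sub, Int.cast_natCast, ZMod.natCast_zmod_val, sub_self]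
  exact_mod_cast h

theorem odd_norm_of_norm_eq (hπ : π.norm = q) (h2 : q ≠ 2) : Odd π.norm := by
  rw [hπ, Int.odd_coe_nat]
  exact hq.out.odd_of_ne_two h2

theorem mod_four_of_norm_eq (hπ : π.norm = q) (h2 : q ≠ 2) : q % 4 = 1 := by
  have := norm_emod_four (odd_norm_of_norm_eq hπ h2)
  omega

/-- The quartic residue character `t ↦ (t/π)₄` of `𝔽_q`, identified with `ℤ[i]/π` for a Gaussian
prime `π` of odd prime norm `q`. -/
noncomputable def quarticChar (hπ : π.norm = q) (h2 : q ≠ 2) : MulChar (ZMod q) GaussianInt where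
  toFun t := quarticResidueSymbol t.val π
  map_one' := by
    refine quarticResidueSymbol_eq_of_dvd (irreducible_of_norm_prime hq.out hπ).not_isUnit
      (odd_norm_of_norm_eq hπ h2) isUnit_one ?_
    rw [ZMod.val_one, Nat.cast_one, one_pow, sub_self]
    exact dvd_zero π
  map_mul' s t := by
    rw [← quarticResidueSymbol_mul (irreducible_of_norm_prime hq.out hπ).prime
      (odd_norm_of_norm_eq hπ h2)]
    simpa using quarticResidueSymbol_val_intCast hπ (s.val * t.val)
  map_nonunit' t ht := by
    rw [isUnit_iff_ne_zero, not_not] at ht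
    rw [ht, ZMod.val_zero, Nat.cast_zero]
    exact quarticResidueSymbol_of_dvd (irreducible_of_norm_prime hq.out hπ).not_isUnit
      (odd_norm_of_norm_eq hπ h2) (dvd_zero π)

theorem quarticChar_intCast (hπ : π.norm = q) (h2 : q ≠ 2) (a : ℤ) :
    quarticChar hπ h2 a = quarticResidueSymbol a π :=
  quarticResidueSymbol_val_intCast hπ a

theorem dvd_pow_sub_quarticChar (hπ : π.norm = q) (h2 : q ≠ 2) (t : ZMod q) :
    π ∣ (t.val : GaussianInt) ^ ((q - 1) / 4) - quarticChar hπ h2 t := by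
  have h1 := mod_four_of_norm_eq hπ h2
  rcases eq_or_ne t 0 with rfl | ht
  · have hexp : (q - 1) / 4 ≠ 0 := by
      have := hq.out.one_lt
      omega
    rw [MulChar.map_zero, ZMod.val_zero, Nat.cast_zero, zero_pow hexp, sub_zero]
    exact dvd_zero π
  · have hnd : ¬ π ∣ (t.val : GaussianInt) := by
      rwa [← Int.cast_natCast, dvd_intCast_iff hπ, Int.cast_natCast, ZMod.natCast_zmod_val]
    have hspec := (quarticResidueSymbol_spec (irreducible_of_norm_prime hq.out hπ).prime
      (odd_norm_of_norm_eq hπ h2) hnd).2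
    rwa [hπ, Int.natAbs_natCast] at hspec

theorem quarticChar_sq_ne_one (hπ : π.norm = q) (h2 : q ≠ 2) : quarticChar hπ h2 ^ 2 ≠ 1 := by
  have h1 := mod_four_of_norm_eq hπ h2
  obtain ⟨t, ht⟩ := FiniteField.exists_nonsquare (F := ZMod q) (by rwa [ZMod.ringChar_zmod_n])
  have ht0 : t ≠ 0 := by
    rintro rfl
    exact ht IsSquare.zero
  refine MulChar.ne_one_iff.2 ⟨Units.mk0 t ht0, fun h => ht ((ZMod.euler_criterion q ht0).2 ?_)⟩
  rw [MulChar.pow_apply_coe, Units.val_mk0] at h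
  have hd := (dvd_pow_sub_quarticChar hπ h2 t).trans (sub_dvd_pow_sub_pow _ _ 2)
  rw [h, ← pow_mul, show (q - 1) / 4 * 2 = q / 2 by omega] at hd
  have hd' : π ∣ (((t.val : ℤ) ^ (q / 2) - 1 : ℤ) : GaussianInt) := by exact_mod_cast hd
  rw [dvd_intCast_iff hπ] at hd'
  simpa [sub_eq_zero] using hd'

open Polynomial in
theorem sum_pow_mul_pow_one_sub_eq_zero (h1 : q % 4 = 1) :
    ∑ t : ZMod q, t ^ ((q - 1) / 4) * ((1 - t) ^ ((q - 1) / 4)) ^ 2 = 0 := by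
  have hq1 := hq.out.one_lt
  have hdeg : (X ^ ((q - 1) / 4) * ((1 - X) ^ ((q - 1) / 4)) ^ 2 : (ZMod q)[X]).natDegree <
      Fintype.card (ZMod q) - 1 := by
    have h : (X ^ ((q - 1) / 4) * ((1 - X) ^ ((q - 1) / 4)) ^ 2 : (ZMod q)[X]).natDegree ≤
        (q - 1) / 4 + 2 * ((q - 1) / 4 * 1) := by
      compute_degree!
    rw [ZMod.card]
    omega
  simpa using sum_eval_eq_zero _ hdeg

theorem dvd_jacobiSum_quarticChar (hπ : π.norm = q) (h2 : q ≠ 2) :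
    π ∣ jacobiSum (quarticChar hπ h2) (quarticChar hπ h2 ^ 2) := by
  set N : ℤ := ∑ t : ZMod q, (t.val : ℤ) ^ ((q - 1) / 4) * (((1 - t).val : ℤ) ^ ((q - 1) / 4)) ^ 2
    with hN
  -- Modulo `π` the Jacobi sum is `N`, the sum over `𝔽_q` of a polynomial of degree below `q - 1`.
  have hN0 : π ∣ (N : GaussianInt) := by
    rw [dvd_intCast_iff hπ, ← sum_pow_mul_pow_one_sub_eq_zero (mod_four_of_norm_eq hπ h2), hN]
    push_cast
    simp only [ZMod.natCast_val, ZMod.cast_id', id_eq]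
  refine (dvd_sub_right hN0).1 ?_
  rw [hN, jacobiSum, Int.cast_sum, ← Finset.sum_sub_distrib]
  refine Finset.dvd_sum fun t _ => ?_
  rw [MulChar.pow_apply' _ two_ne_zero]
  push_cast
  exact dvd_mul_sub_mul (dvd_pow_sub_quarticChar hπ h2 t)
    ((dvd_pow_sub_quarticChar hπ h2 (1 - t)).trans (sub_dvd_pow_sub_pow _ _ 2))

theorem mul_sq_eq_inv {G : Type*} [Group G] {g : G} (h : g ^ 4 = 1) : g * g ^ 2 = g⁻¹ := by
  rw [eq_inv_iff_mul_eq_one, ← pow_succ', ← pow_succ, h]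

theorem jacobiSum_quarticChar (hπ : π.norm = q) (h2 : q ≠ 2) (hprim : IsPrimary π) :
    jacobiSum (quarticChar hπ h2) (quarticChar hπ h2 ^ 2) = -π := by
  set χ := quarticChar hπ h2
  obtain ⟨c, hc⟩ : π ∣ jacobiSum χ (χ ^ 2) := dvd_jacobiSum_quarticChar hπ h2
  have hχ2 : χ ^ 2 ≠ 1 := quarticChar_sq_ne_one hπ h2
  have hχ1 : χ ≠ 1 := fun h => hχ2 (by rw [h, one_pow])
  have hχ3 : χ * χ ^ 2 ≠ 1 := by
    rwa [mul_sq_eq_inv (mulChar_pow_four χ), Ne, inv_eq_one]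
  have hcu : IsUnit (-c) := by
    have hn := norm_jacobiSum (by rw [ZMod.ringChar_zmod_n]; exact hq.out.ne_zero) hχ1 hχ2 hχ3
    rw [hc, Zsqrtd.norm_mul, hπ, ZMod.card] at hn
    rw [IsUnit.neg_iff, ← Zsqrtd.norm_eq_one_iff' (by norm_num)]
    exact mul_left_cancel₀ (Int.natCast_ne_zero.2 hq.out.ne_zero) (hn.trans (mul_one _).symm)
  have hprim' : IsPrimary (-c * π) := by
    have hq4 : IsPrimary (q : GaussianInt) := by
      have h1 := mod_four_of_norm_eq hπ h2
      simpa only [pstar_of_one h1, Int.cast_natCast] using isPrimary_pstar hq.out h2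
    have hd := dvd_jacobiSum_add_card hχ2
    rw [ZMod.card, hc] at hd
    rw [IsPrimary, show -c * π - 1 = (q - 1 : GaussianInt) - (π * c + q) by ring]
    exact dvd_sub hq4 hd
  have hc1 := (hprim.of_mul_right hprim').eq_one_of_isUnit hcu
  rw [hc, neg_eq_iff_eq_neg.1 hc1, mul_neg_one]

end QuarticCharacter

section GaussSum

variable {q : ℕ} [hq : Fact q.Prime] {R : Type*} [Field R] {χ : MulChar (ZMod q) R}
  {ψ : AddChar (ZMod q) R}

theorem gaussSum_mul_gaussSum_inv (hψ : ψ.IsPrimitive) (hχ : χ ≠ 1) :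
    gaussSum χ ψ * gaussSum χ⁻¹ ψ = χ (-1) * q := by
  have h := gaussSum_mul_gaussSum_eq_card hχ hψ
  rw [ZMod.card] at h
  rw [← mul_gaussSum_inv_eq_gaussSum χ⁻¹ ψ, mul_left_comm, h, MulChar.inv_apply', inv_neg_one]

theorem gaussSum_pow_four (hq0 : (q : R) ≠ 0) (hψ : ψ.IsPrimitive) (hχ4 : χ ^ 4 = 1)
    (hχ2 : χ ^ 2 ≠ 1) : gaussSum χ ψ ^ 4 = jacobiSum χ (χ ^ 2) ^ 2 * q := by
  have hχ1 : χ ≠ 1 := fun h => hχ2 (by rw [h, one_pow])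
  have hinv : χ * χ ^ 2 = χ⁻¹ := mul_sq_eq_inv hχ4
  have hinv2 : (χ ^ 2)⁻¹ = χ ^ 2 := by
    rw [inv_eq_iff_mul_eq_one, ← pow_add, hχ4]
  have hneg : χ (-1) ^ 2 = 1 := by rw [← map_pow, neg_one_sq, map_one]
  have hjac := jacobiSum_mul_nontrivial (χ := χ) (φ := χ ^ 2)
    (by rwa [hinv, Ne, inv_eq_one]) ψ
  have hmul := gaussSum_mul_gaussSum_inv hψ hχ1
  have hmul2 := gaussSum_mul_gaussSum_inv hψ hχ2
  rw [hinv2, MulChar.pow_apply' _ two_ne_zero, hneg] at hmul2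
  rw [hinv] at hjac
  have hsq : gaussSum χ ψ ^ 2 * gaussSum (χ ^ 2) ψ = χ (-1) * q * jacobiSum χ (χ ^ 2) := by
    linear_combination -gaussSum χ ψ * hjac + jacobiSum χ (χ ^ 2) * hmul
  apply mul_right_cancel₀ hq0
  linear_combination -gaussSum χ ψ ^ 4 * hmul2 +
    (gaussSum χ ψ ^ 2 * gaussSum (χ ^ 2) ψ + χ (-1) * q * jacobiSum χ (χ ^ 2)) * hsq +
    (q : R) ^ 2 * jacobiSum χ (χ ^ 2) ^ 2 * hneg

variable {p : ℕ} [Fact p.Prime] [CharP R p]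

theorem gaussSum_pow_char (hpq : IsUnit (p : ZMod q)) (χ : MulChar (ZMod q) R)
    (ψ : AddChar (ZMod q) R) :
    gaussSum χ ψ ^ p = (χ ^ p)⁻¹ p * gaussSum (χ ^ p) ψ := by
  rw [gaussSum_frob, AddChar.pow_mulShift, ← hpq.unit_spec, gaussSum_mulShift_eq]

theorem mulChar_mul_gaussSum_pow_of_one (h1 : p % 4 = 1) (hpq : IsUnit (p : ZMod q))
    (hG : gaussSum χ ψ ≠ 0) (hχ4 : χ ^ 4 = 1) : χ p * gaussSum χ ψ ^ (p - 1) = 1 := by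
  have hpow : χ ^ p = χ := by
    rw [show p = 4 * (p / 4) + 1 by omega, pow_succ, pow_mul, hχ4, one_pow, one_mul]
  have h := gaussSum_pow_char hpq χ ψ
  rw [hpow, MulChar.inv_apply_eq_inv'] at h
  refine mul_right_cancel₀ hG ?_
  rw [mul_assoc, ← pow_succ, show p - 1 + 1 = p by omega, h,
    mul_inv_cancel_left₀ (hpq.map χ).ne_zero, one_mul]

theorem gaussSum_pow_of_three (h3 : p % 4 = 3) (hpq : IsUnit (p : ZMod q)) (hψ : ψ.IsPrimitive)
    (hχ4 : χ ^ 4 = 1) (hχ : χ ≠ 1) : gaussSum χ ψ ^ (p + 1) = χ (-p) * q := by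
  have hpow : χ ^ p = χ⁻¹ := by
    rw [eq_inv_iff_mul_eq_one, ← pow_succ, show p + 1 = 4 * ((p + 1) / 4) by omega, pow_mul, hχ4,
      one_pow]
  rw [pow_succ, gaussSum_pow_char hpq, hpow, inv_inv, mul_assoc, mul_comm (gaussSum χ⁻¹ ψ),
    gaussSum_mul_gaussSum_inv hψ hχ, ← mul_assoc, ← map_mul, mul_neg_one]

end GaussSum

section Reciprocity

variable {p q : ℕ} [hp : Fact p.Prime] [hq : Fact q.Prime] {π γ : GaussianInt}

theorem mulChar_pstar_of_gaussSum_pow_four {R : Type*} [Field R] [CharP R p]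
    (φ : GaussianInt →+* R) (hp2 : p ≠ 2) (hπ : π.norm = q) (hpπ : ¬ (p : ℤ) ∣ π.norm)
    (hpq : IsUnit (p : ZMod q)) {χ : MulChar (ZMod q) R} {ψ : AddChar (ZMod q) R}
    (hψ : ψ.IsPrimitive) (hχ4 : χ ^ 4 = 1) (hχ : χ ≠ 1)
    (hG : gaussSum χ ψ ^ 4 = φ π ^ 3 * φ (star π)) :
    χ (pstar p) = (φ π / φ (star π)) ^ ((pstar p - 1) / 4) := by
  have hA : φ π ≠ 0 := hom_ne_zero φ hpπ
  have hB : φ (star π) ≠ 0 := hom_star_ne_zero φ hpπ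
  have hG0 : gaussSum χ ψ ≠ 0 := fun h => by
    rw [h, zero_pow four_ne_zero] at hG
    exact mul_ne_zero (pow_ne_zero 3 hA) hB hG.symm
  rcases mod_four_of_prime hp.out hp2 with h | h
  · have hGn := mulChar_mul_gaussSum_pow_of_one h hpq hG0 hχ4
    have hAn := mul_right_cancel₀ hA <| (pow_succ _ _).symm.trans <|
      (congrArg (φ π ^ ·) (show p - 1 + 1 = p by omega)).trans <|
      (hom_pow_char_of_one φ h π).trans (one_mul _).symm
    rw [show p - 1 = 4 * (p / 4) by omega, pow_mul] at hGn hAn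
    rw [pstar_of_one h, show ((p : ℤ) - 1) / 4 = (p / 4 : ℕ) by omega, zpow_natCast, div_pow,
      eq_div_iff (pow_ne_zero _ hB), Int.cast_natCast]
    refine mul_left_cancel₀ (pow_ne_zero (p / 4) (pow_ne_zero 3 hA)) ?_
    rw [hG, mul_pow] at hGn
    rw [← mul_pow, ← pow_succ, hAn, ← hGn]
    ring
  · have hGn := gaussSum_pow_of_three h hpq hψ hχ4 hχ
    have hAn : φ π ^ (p + 1) = φ π * φ (star π) := by
      rw [pow_succ', hom_pow_char_of_three φ h]
    have hAB : φ π * φ (star π) = q := by rw [hom_mul_star, hπ, Int.cast_natCast]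
    rw [← hAB, ← hAn, show p + 1 = 4 * ((p + 1) / 4) by omega, pow_mul, pow_mul, hG, mul_pow] at hGn
    rw [pstar_of_three h, show (-(p : ℤ) - 1) / 4 = -((p + 1) / 4 : ℕ) by omega, zpow_neg,
      zpow_natCast, ← inv_pow, inv_div, div_pow, eq_div_iff (pow_ne_zero _ hA), Int.cast_neg,
      Int.cast_natCast]
    refine mul_left_cancel₀ (pow_ne_zero ((p + 1) / 4) (pow_ne_zero 3 hA)) ?_
    rw [hGn]
    ring

theorem hom_quarticChar_pstar {R : Type*} [Field R] [CharP R p] (φ : GaussianInt →+* R)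
    {ψ : AddChar (ZMod q) R} (hψ : ψ.IsPrimitive) (hp2 : p ≠ 2) (hπ : π.norm = q) (h2 : q ≠ 2)
    (hprim : IsPrimary π) (hpq : p ≠ q) :
    φ (quarticChar hπ h2 (pstar p)) = (φ π / φ (star π)) ^ ((pstar p - 1) / 4) := by
  have hpπ : ¬ (p : ℤ) ∣ π.norm := by
    rwa [hπ, Int.natCast_dvd_natCast, Nat.prime_dvd_prime_iff_eq hp.out hq.out]
  have hpq' : IsUnit (p : ZMod q) := by
    rwa [isUnit_iff_ne_zero, Ne, ZMod.natCast_eq_zero_iff,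
      Nat.prime_dvd_prime_iff_eq hq.out hp.out, eq_comm]
  set χ := (quarticChar hπ h2).ringHomComp φ with hχ
  have hχ4 : χ ^ 4 = 1 := by
    rw [hχ, MulChar.ringHomComp_pow, mulChar_pow_four, MulChar.ringHomComp_one]
  have hχ2 : χ ^ 2 ≠ 1 := by
    rw [hχ, MulChar.ringHomComp_pow]
    exact ringHomComp_ne_one φ (Ring.two_ne_zero (by rwa [ringChar.eq R p]))
      (quarticChar_sq_ne_one hπ h2)
  have hχ1 : χ ≠ 1 := fun h => hχ2 (by rw [h, one_pow])
  have hqAB : φ π * φ (star π) = q := by rw [hom_mul_star, hπ, Int.cast_natCast]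
  have hq0 : (q : R) ≠ 0 := hqAB ▸ mul_ne_zero (hom_ne_zero φ hpπ) (hom_star_ne_zero φ hpπ)
  refine mulChar_pstar_of_gaussSum_pow_four φ hp2 hπ hpπ hpq' hψ hχ4 hχ1 ?_
  rw [gaussSum_pow_four hq0 hψ hχ4 hχ2, hχ, MulChar.ringHomComp_pow, jacobiSum_ringHomComp,
    jacobiSum_quarticChar hπ h2 hprim, ← hqAB, map_neg]
  ring

theorem quarticJacobiSymbol_eq_of_norm_prime (hp2 : p ≠ 2) (hπ : π.norm = q)
    (hprim : IsPrimary π) (hpq : p ≠ q) :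
    quarticJacobiSymbol π p = quarticJacobiSymbol (pstar p) π := by
  have h2 : q ≠ 2 := by
    rintro rfl
    exact absurd hprim.odd_norm (by rw [hπ]; decide)
  have hpπ : ¬ (p : ℤ) ∣ π.norm := by
    rwa [hπ, Int.natCast_dvd_natCast, Nat.prime_dvd_prime_iff_eq hp.out hq.out]
  obtain ⟨φ⟩ := exists_hom_algebraicClosure p
  have : NeZero (q : AlgebraicClosure (ZMod p)) := ⟨fun h => hpq <|
    (Nat.prime_dvd_prime_iff_eq hp.out hq.out).1 ((CharP.cast_eq_zero_iff _ p q).1 h)⟩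
  obtain ⟨ζ, hζ⟩ := HasEnoughRootsOfUnity.exists_primitiveRoot (AlgebraicClosure (ZMod p)) q
  rw [quarticJacobiSymbol_of_irreducible _ (irreducible_of_norm_prime hq.out hπ),
    ← quarticChar_intCast hπ h2]
  refine quarticJacobiSymbol_eq_of_hom φ hp2 hpπ (IsUnit.map _ ?_) <| hom_quarticChar_pstar φ
    (AddChar.zmodChar_primitive_of_primitive_root q hζ) hp2 hπ h2 hprim hpq
  rw [isUnit_iff_ne_zero, Ne, ZMod.intCast_zmod_eq_zero_iff_dvd]
  exact not_natCast_dvd_pstar hp.out hq.out hp2 hpq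

theorem quarticJacobiSymbol_pstar_of_prime (hp2 : p ≠ 2) (hπ : Prime π) (hprim : IsPrimary π) :
    quarticJacobiSymbol π p = quarticJacobiSymbol (pstar p) π := by
  by_cases hd : π ∣ (p : GaussianInt)
  · have hd' : π ∣ (pstar p : GaussianInt) := by
      rw [pstar, Int.cast_mul, Int.cast_natCast]
      exact hd.mul_left _
    rw [quarticJacobiSymbol_eq_zero hπ (odd_norm_natCast hp2) dvd_rfl hd,
      quarticJacobiSymbol_eq_zero hπ hprim.odd_norm hd' dvd_rfl]
  obtain ⟨q, hq, ⟨-, hn⟩ | ⟨h3, hassoc⟩⟩ := norm_eq_or_associated_of_prime hπ hprim.odd_norm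
  · have : Fact q.Prime := ⟨hq⟩
    refine quarticJacobiSymbol_eq_of_norm_prime hp2 hn hprim ?_
    rintro rfl
    exact hd ⟨star π, by rw [← Zsqrtd.norm_eq_mul_conj, hn, Int.cast_natCast]⟩
  · have : Fact q.Prime := ⟨hq⟩
    have hq2 : q ≠ 2 := by omega
    have hpq : p ≠ q := by
      rintro rfl
      exact hd hassoc.symm.dvd
    have hπq : π = (pstar q : GaussianInt) := by
      refine hprim.eq_of_associated (isPrimary_pstar hq hq2) ?_
      rw [pstar_of_three h3, Int.cast_neg, Int.cast_natCast]
      exact (Associated.refl _).neg_left.trans hassoc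
    have hright : quarticJacobiSymbol (pstar p) (pstar q) = 1 := by
      rw [pstar_of_three h3, Int.cast_neg, Int.cast_natCast, ← neg_one_mul (q : GaussianInt),
        quarticJacobiSymbol_mul_right _ (neg_ne_zero.2 one_ne_zero)
          (Nat.cast_ne_zero.2 hq.ne_zero), quarticJacobiSymbol_of_isUnit _ isUnit_one.neg, one_mul,
        quarticJacobiSymbol_intCast hq2 (not_natCast_dvd_pstar hp.out hq hp2 hpq)]
    rw [hπq, hright, quarticJacobiSymbol_intCast hp2 (not_natCast_dvd_pstar hq hp.out hq2 hpq.symm)]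

theorem quarticJacobiSymbol_pstar (hp2 : p ≠ 2) (hγ : IsPrimary γ) :
    quarticJacobiSymbol γ p = quarticJacobiSymbol (pstar p) γ := by
  have hodd : Odd (Zsqrtd.norm (p : GaussianInt)) := odd_norm_natCast hp2
  suffices h : ∃ u, IsUnit u ∧ IsPrimary (u * γ) ∧
      quarticJacobiSymbol (u * γ) p = quarticJacobiSymbol (pstar p) (u * γ) by
    obtain ⟨u, hu, hprim, h⟩ := h
    rwa [(hγ.of_mul_right hprim).eq_one_of_isUnit hu, one_mul] at h
  have hγodd := hγ.odd_norm
  clear hγ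
  induction γ using UniqueFactorizationMonoid.induction_on_prime with
  | h₁ => simp at hγodd
  | h₂ v hv =>
    refine ⟨star v, hv.star, ?_⟩
    rw [mul_comm, mul_star_eq_one hv, quarticJacobiSymbol_of_isUnit _ isUnit_one]
    exact ⟨isPrimary_one, quarticJacobiSymbol_one_left hp2⟩
  | h₃ a π ha hπ ih =>
    obtain ⟨u, hu, hprim⟩ := exists_isPrimary_mul (odd_norm_of_dvd (dvd_mul_right π a) hγodd)
    obtain ⟨v, hv, hprim', hrec'⟩ := ih (odd_norm_of_dvd (dvd_mul_left a π) hγodd)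
    have hrec := quarticJacobiSymbol_pstar_of_prime hp2
      ((associated_unit_mul_left π u hu).symm.prime hπ) hprim
    refine ⟨u * v, hu.mul hv, ?_⟩
    rw [mul_mul_mul_comm]
    refine ⟨hprim.mul hprim', ?_⟩
    rw [quarticJacobiSymbol_mul_left hodd, quarticJacobiSymbol_mul_right _
      (mul_ne_zero hu.ne_zero hπ.ne_zero) (mul_ne_zero hv.ne_zero ha), hrec, hrec']

end Reciprocity

section Periodicity

variable {p p' : ℕ} [hp : Fact p.Prime] [hp' : Fact p'.Prime] {β γ : GaussianInt}

theorem quarticJacobiSymbol_eq_of_eq_mul_star (h2 : p ≠ 2) (h2' : p' ≠ 2)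
    (hα : ¬ (p : ℤ) ∣ β.norm) (hα' : ¬ (p' : ℤ) ∣ β.norm) {w : GaussianIntˣ}
    (hw : β = w * star β) {n : ℤ} (hn : w ^ n = 1) (h : pstar p ≡ pstar p' [ZMOD 4 * n]) :
    quarticJacobiSymbol β p = quarticJacobiSymbol β p' := by
  rw [quarticJacobiSymbol_of_eq_mul_star h2 hα w hw,
    quarticJacobiSymbol_of_eq_mul_star h2' hα' w hw]
  obtain ⟨a, ha⟩ := (pstar_modEq_one hp.out h2).symm.dvd
  obtain ⟨c, hc⟩ := h.dvd
  rw [show (pstar p' - 1) / 4 = (pstar p - 1) / 4 + n * c by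
    rw [ha, show pstar p' - 1 = 4 * (a + n * c) by linear_combination ha + hc]
    simp, zpow_add, zpow_mul, hn, one_zpow, mul_one]

theorem IsPrimary.quarticJacobiSymbol_eq (hγ : IsPrimary γ) (h2 : p ≠ 2) (h2' : p' ≠ 2)
    (h : pstar p ≡ pstar p' [ZMOD γ.norm]) :
    quarticJacobiSymbol γ p = quarticJacobiSymbol γ p' := by
  rw [quarticJacobiSymbol_pstar h2 hγ, quarticJacobiSymbol_pstar h2' hγ]
  refine quarticJacobiSymbol_congr ?_
  have hγN : γ ∣ (γ.norm : GaussianInt) := ⟨star γ, Zsqrtd.norm_eq_mul_conj γ⟩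
  rw [← Int.cast_sub]
  exact hγN.trans ((Zsqrtd.intCast_dvd_intCast _ _).2 h.symm.dvd)

theorem quarticJacobiSymbol_eq_of_modEq_eight_mul_norm (hβ : β ≠ 0) (h2 : p ≠ 2) (h2' : p' ≠ 2)
    (h : pstar p ≡ pstar p' [ZMOD 8 * β.norm]) :
    quarticJacobiSymbol β p = quarticJacobiSymbol β p' := by
  obtain ⟨k, η, γ, w, rfl, hγ, hη, hw, hw2⟩ := exists_eq_mul_isPrimary hβ
  rw [Zsqrtd.norm_mul, hη] at h
  rw [quarticJacobiSymbol_mul_left (odd_norm_natCast h2),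
    quarticJacobiSymbol_mul_left (odd_norm_natCast h2')]
  congr 1
  · refine quarticJacobiSymbol_eq_of_eq_mul_star h2 h2' ?_ ?_ hw (n := (2 * 2 ^ k : ℕ))
      (by rwa [zpow_natCast]) (h.of_dvd ⟨γ.norm, by push_cast; ring⟩)
    · rw [hη]
      exact not_natCast_dvd_two_pow hp.out h2 k
    · rw [hη]
      exact not_natCast_dvd_two_pow hp'.out h2' k
  · exact hγ.quarticJacobiSymbol_eq h2 h2' (h.of_dvd ⟨8 * 2 ^ k, by ring⟩)

theorem quarticJacobiSymbol_mk_eq_of_odd {b : ℤ} (hb : Odd b) (m : ℤ) (h2 : p ≠ 2) (h2' : p' ≠ 2)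
    (h : pstar p ≡ pstar p' [ZMOD b ^ 2 + 4 * m ^ 2]) :
    quarticJacobiSymbol ⟨b, 2 * m⟩ p = quarticJacobiSymbol ⟨b, 2 * m⟩ p' := by
  rw [← norm_mk] at h
  rcases isPrimary_mk_or_isPrimary_neg hb m with hprim | hprim
  · exact hprim.quarticJacobiSymbol_eq h2 h2' h
  · rw [← Zsqrtd.norm_neg] at h
    rw [← quarticJacobiSymbol_neg h2, ← quarticJacobiSymbol_neg h2']
    exact hprim.quarticJacobiSymbol_eq h2 h2' h

theorem quarticJacobiSymbol_mk_eq_of_even {b m : ℤ} (hb : Even b) (hb0 : b ≠ 0) (h2 : p ≠ 2)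
    (h2' : p' ≠ 2) (h : pstar p ≡ pstar p' [ZMOD 2 * (b ^ 2 + 4 * m ^ 2)]) :
    quarticJacobiSymbol ⟨b, 2 * m⟩ p = quarticJacobiSymbol ⟨b, 2 * m⟩ p' := by
  obtain ⟨c, rfl⟩ := even_iff_exists_two_mul.1 hb
  have hβ : (⟨c, m⟩ : GaussianInt) ≠ 0 := fun h0 => hb0 (by
    rw [show c = 0 from congrArg Zsqrtd.re h0, mul_zero])
  have hdouble : (⟨2 * c, 2 * m⟩ : GaussianInt) = ((2 : ℤ) : GaussianInt) * ⟨c, m⟩ := by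
    rw [Zsqrtd.smul_val]
  rw [hdouble,
    quarticJacobiSymbol_intCast_mul h2 (by simpa using not_natCast_dvd_two_pow hp.out h2 1),
    quarticJacobiSymbol_intCast_mul h2' (by simpa using not_natCast_dvd_two_pow hp'.out h2' 1)]
  refine quarticJacobiSymbol_eq_of_modEq_eight_mul_norm hβ h2 h2' ?_
  rwa [norm_eq, show 8 * (c ^ 2 + m ^ 2) = 2 * ((2 * c) ^ 2 + 4 * m ^ 2) by ring]

theorem quarticSign_eq_of_modEq {b m : ℤ} (hb0 : b ≠ 0) (h2 : p ≠ 2) (h2' : p' ≠ 2)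
    (h : (p' : ℤ) ≡ p [ZMOD (3 - (((-1 : ℤˣ) ^ b : ℤˣ) : ℤ)) * (b ^ 2 + 4 * m ^ 2)] ∨
      (p' : ℤ) ≡ -p [ZMOD (3 - (((-1 : ℤˣ) ^ b : ℤˣ) : ℤ)) * (b ^ 2 + 4 * m ^ 2)]) :
    quarticSign b m p = quarticSign b m p' := by
  suffices hsym : quarticJacobiSymbol ⟨b, 2 * m⟩ p = quarticJacobiSymbol ⟨b, 2 * m⟩ p' by
    rw [quarticSign, quarticSign, hsym]
  rcases Int.even_or_odd b with hb | hb <;> rw [hb.neg_one_zpow] at h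
  · have h4 : 4 ∣ 2 * (b ^ 2 + 4 * m ^ 2) := by
      obtain ⟨c, rfl⟩ := even_iff_exists_two_mul.1 hb
      exact ⟨2 * (c ^ 2 + m ^ 2), by ring⟩
    exact quarticJacobiSymbol_mk_eq_of_even hb hb0 h2 h2' (pstar_modEq h4 h)
  · have h4 : 4 ∣ 4 * (b ^ 2 + 4 * m ^ 2) := dvd_mul_right _ _
    exact quarticJacobiSymbol_mk_eq_of_odd hb m h2 h2' ((pstar_modEq h4 h).of_mul_left _)

end Periodicity

end QuarticSums

theorem theorem2p11 (b m : ℤ) :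
    ∃ δ : ℕ → ℤ,
      (∀ (p : ℕ) [Fact p.Prime], p ≠ 2 → ¬ (p : ℤ) ∣ b * m * (b ^ 2 + 4 * m ^ 2) →
        (δ p = 1 ∨ δ p = -1) ∧
        QuarticSums.SumCongruences b m p (δ p) ∧
        -- uniqueness of the sign, except where both sums vanish modulo `p`
        (¬ (p % 4 = 1 ∧ legendreSym p (b ^ 2 + 4 * m ^ 2) = -1) →
          ∀ ε : ℤ, (ε = 1 ∨ ε = -1) → QuarticSums.SumCongruences b m p ε → ε = δ p) ∧
        (legendreSym p (b ^ 2 + 4 * m ^ 2) = 1 →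
          (δ p : GaussianInt) =
            QuarticSums.quarticJacobiSymbol (⟨b, 2 * m⟩ : GaussianInt) (p : GaussianInt)) ∧
        (legendreSym p (b ^ 2 + 4 * m ^ 2) = -1 →
          (δ p : GaussianInt) =
            QuarticSums.quarticJacobiSymbol (⟨b, 2 * m⟩ : GaussianInt) (p : GaussianInt) *
              QuarticSums.gI)) ∧
      (∀ p p' : ℕ, p.Prime → p'.Prime → p ≠ 2 → p' ≠ 2 →
        ¬ (p : ℤ) ∣ b * m * (b ^ 2 + 4 * m ^ 2) →
        ¬ (p' : ℤ) ∣ b * m * (b ^ 2 + 4 * m ^ 2) →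
        ((p' : ℤ) ≡ (p : ℤ) [ZMOD (3 - (((-1 : ℤˣ) ^ b : ℤˣ) : ℤ)) * (b ^ 2 + 4 * m ^ 2)] ∨
          (p' : ℤ) ≡ -(p : ℤ) [ZMOD (3 - (((-1 : ℤˣ) ^ b : ℤˣ) : ℤ)) * (b ^ 2 + 4 * m ^ 2)]) →
        δ p = δ p') := by
  have hfactors {p : ℕ} (h : ¬ (p : ℤ) ∣ b * m * (b ^ 2 + 4 * m ^ 2)) :
      ¬ (p : ℤ) ∣ b ∧ ¬ (p : ℤ) ∣ m ∧ ¬ (p : ℤ) ∣ b ^ 2 + 4 * m ^ 2 :=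
    ⟨fun hb => h ((hb.mul_right _).mul_right _), fun hm => h ((hm.mul_left _).mul_right _),
      fun hD => h (hD.mul_left _)⟩
  refine ⟨QuarticSums.quarticSign b m, fun p _ h2 hd => ?_, fun p p' hp hp' h2 h2' hd _ h => ?_⟩
  · obtain ⟨hb, hm, hD⟩ := hfactors hd
    have hδ := QuarticSums.quarticSign_eq_one_or_neg_one h2 hD
    have hpos := QuarticSums.intCast_quarticSign_of_legendreSym_eq_one h2 hD
    have hneg := QuarticSums.intCast_quarticSign_of_legendreSym_eq_neg_one h2 hD
    have hS := QuarticSums.sumCongruences_of_quarticJacobiSymbol h2 hb hm hD hpos hneg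
    exact ⟨hδ, hS, fun hne ε hε hSε =>
      QuarticSums.sign_eq_of_sumCongruences h2 hb hm hD hne hδ hε hS hSε, hpos, hneg⟩
  · have : Fact p.Prime := ⟨hp⟩
    have : Fact p'.Prime := ⟨hp'⟩
    have hb0 : b ≠ 0 := by
      rintro rfl
      exact (hfactors hd).1 (dvd_zero _)
    exact QuarticSums.quarticSign_eq_of_modEq hb0 h2 h2' h
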